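/- Exclusion game. For integers $1\le m\le n$ and $\gamma\ge 0$, in the game $\mathrm{EXC}_{n,m,\gamma}$ Alice receives a uniformly random string $x\in\{0,1\}^n$ and Bob a uniformly random subset $y\subseteq[n]$ with $|y|=m$. Alice sends a single (classical or quantum) message to Bob, who outputs an $m$-bit string $z$; they win if $z\neq \mathcal M_y(x)$, the restriction of $x$ to the positions in $y$. A protocol is winning if its probability of error is at most $\gamma$. Public randomness (from a finite set) and unlimited private resources are allowed, prior entanglement is not. For a protocol $\Pi$, its communication cost is the maximal number of bits (qubits) sent in any run. The information cost of a quantum protocol is $\sup_\mu I(X:\Pi|Y)$, the supremum over all joint distributions $\mu$ of the inputs $(X,Y)$, where $\Pi$ in the mutual information stands for the message together with the public randomness and $I(S:T|U)=H(SU)+H(TU)-H(STU)-H(U)$ with $H$ the (von Neumann) entropy. Let $\bar C_{CC}$, $\bar Q_{CC}$, $\bar Q_{IC}$ be the infima, over all winning one-way protocols, of the classical communication cost, the quantum communication cost and the quantum information cost. For a function $f$ write $f\in\tilde o(n)$ if $f\in o(n\log^k n)$ for every integer $k$ (positive or negative). For eventually positive $g_1,g_2:\mathbb N\to\mathbb R$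 the gap between $g_1$ and $g_2$ is infinite if there is no strictly increasing $g:\mathbb R\to\mathbb R$ with $\log g_2(n)\sim g(\log g_1(n))$ as $n\to\infty$. If $\lim_{n\to\infty} g_2(n)/g_1(n)\ge 1$ (the limit may be $+\infty$), the gap is doubly infinite if there is an eventually positive $g_m$ with $\lim g_2(n)/g_m(n)\ge 1$ and $\lim g_m(n)/g_1(n)\ge 1$ such that the gap between $g_1$ and $g_m$ and the gap between $g_m$ and $g_2$ are both infinite. The gap between $g_1$ and $g_2$ is at most exponential if $g_2\in 2^{O(g_1)}$. Statement. Let $m=m(n)$ satisfy $m\in\omega(\sqrt{n\log n})$ and $m\in\tilde o(n)$. Then, for the games $\mathrm{EXC}_{n,m,0}$, as $n\to\infty$: (1) $\bar Q_{IC}\in O(n\,m^{-2}\log m)$, and $\bar Q_{IC}\to 0$; (2) $\bar Q_{CC}\in\Omega(\log n)$; in particular $\bar Q_{CC}\to\infty$; (3) $\bar C_{CC}\in\Theta(n)$; (4) the gap between $\bar Q_{IC}$ and $\bar Q_{CC}$ is doubly infinite; (5) the gap between $\bar Q_{CC}$ and $\bar C_{CC}$ is at most exponential: $\bar C_{CC}\le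 2^{O(\bar Q_{CC})}$. -/

import Mathlib

open Filter Asymptotics Topology
open scoped ComplexOrder

noncomputable section

namespace Exclusion

/-! ### The exclusion game -/

/-- Alice's inputs: `n`-bit strings. -/
abbrev AliceInput (n : ℕ) : Type := Fin n → Bool

/-- Bob's inputs: subsets of `[n]` of size `m`. -/
abbrev BobInput (n m : ℕ) : Type := {y : Finset (Fin n) // y.card = m}

/-- Bob's possible outputs: `m`-bit strings. -/
abbrev Answer (m : ℕ) : Type := Fin m → Bool

/-- The string `x` restricted to the bits specified by `y`, read in increasing order. -/
def restrict {n m : ℕ} (x : AliceInput n) (y : BobInput n m) : Answer m :=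
  fun i => x (y.1.orderEmbOfFin y.2 i)

/-- The average over a uniformly random pair of inputs. -/
def uniformAverage {n m : ℕ} (f : AliceInput n → BobInput n m → ℝ) : ℝ :=
  (∑ x, ∑ y, f x y) / (Fintype.card (AliceInput n) * Fintype.card (BobInput n m))

/-! ### One-way classical protocols -/

/-- A one-way classical protocol with public randomness (a random element of `Fin coins`) and
unlimited private randomness on both sides: Alice sends a random bit string depending on the
public randomness and on her input; Bob's random answer depends on the public randomness,
his input and the string received. -/
structure ClassicalProtocol (n m : ℕ) where
  coins : ℕ
  coin : Fin coins → ℝ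
  coin_mem : coin ∈ stdSimplex ℝ (Fin coins)
  message : Fin coins → AliceInput n → PMF (List Bool)
  answer : Fin coins → BobInput n m → List Bool → PMF (Answer m)

namespace ClassicalProtocol

variable {n m : ℕ}

/-- The probability that Bob outputs the forbidden string on the inputs `x`, `y`. -/
def errorProb (P : ClassicalProtocol n m) (x : AliceInput n) (y : BobInput n m) : ℝ :=
  ∑ r, P.coin r * (((P.message r x).bind (P.answer r y)) (restrict x y)).toReal

/-- The protocol wins the game with allowed probability of error `γ`. -/
def Wins (P : ClassicalProtocol n m) (γ : ℝ) : Prop :=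
  uniformAverage P.errorProb ≤ γ

/-- At most `c` bits are sent in any run, for all inputs and all values of the randomness. -/
def CostAtMost (P : ClassicalProtocol n m) (c : ℕ) : Prop :=
  ∀ r x, ∀ w ∈ (P.message r x).support, w.length ≤ c

end ClassicalProtocol

/-- Classical communication complexity: the least worst-case number of bits sent by a winning
classical protocol. -/
def classicalCC (n m : ℕ) (γ : ℝ) : ℕ :=
  sInf {c : ℕ | ∃ P : ClassicalProtocol n m, P.Wins γ ∧ P.CostAtMost c}

/-! ### One-way quantum protocols -/

/-- A one-way quantum protocol with public randomness and without shared entanglement. Given the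
public randomness and her input, Alice prepares a (mixed) state of `qubits` qubits and sends it;
Bob applies a POVM, indexed by his possible answers, that depends on the public randomness and
on his input. -/
structure QuantumProtocol (n m : ℕ) where
  coins : ℕ
  coin : Fin coins → ℝ
  coin_mem : coin ∈ stdSimplex ℝ (Fin coins)
  qubits : ℕ
  state : Fin coins → AliceInput n → Matrix (Fin qubits → Bool) (Fin qubits → Bool) ℂ
  state_posSemidef : ∀ r x, (state r x).PosSemidef
  state_trace : ∀ r x, (state r x).trace = 1
  povm : Fin coins → BobInput n m → Answer m →
    Matrix (Fin qubits → Bool) (Fin qubits → Bool) ℂ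
  povm_posSemidef : ∀ r y z, (povm r y z).PosSemidef
  povm_sum : ∀ r y, ∑ z, povm r y z = 1

/-- Shannon entropy (in bits) of a finitely supported weight. -/
def shannonEntropy {ι : Type*} [Fintype ι] (p : ι → ℝ) : ℝ :=
  (∑ i, Real.negMulLog (p i)) / Real.log 2

/-- Von Neumann entropy (in bits) `-tr (ρ log₂ ρ)`, the Shannon entropy of the eigenvalues;
it is only used for Hermitian matrices. -/
def vonNeumannEntropy {ι : Type*} [Fintype ι] [DecidableEq ι] (ρ : Matrix ι ι ℂ) : ℝ :=
  open Classical in if h : ρ.IsHermitian then shannonEntropy h.eigenvalues else 0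

namespace QuantumProtocol

variable {n m : ℕ}

/-- The probability (Born's rule) that Bob outputs the forbidden string on the inputs `x`, `y`. -/
def errorProb (P : QuantumProtocol n m) (x : AliceInput n) (y : BobInput n m) : ℝ :=
  ∑ r, P.coin r * (P.state r x * P.povm r y (restrict x y)).trace.re

/-- The protocol wins the game with allowed probability of error `γ`. -/
def Wins (P : QuantumProtocol n m) (γ : ℝ) : Prop :=
  uniformAverage P.errorProb ≤ γ

/-- The joint state of Alice's input, Bob's input, the public randomness and the message, when the
inputs have the joint distribution `μ`. The first three registers are classical, so the
density matrix is block diagonal. -/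
def stateXYPi (P : QuantumProtocol n m) (μ : AliceInput n × BobInput n m → ℝ) :
    Matrix ((Fin P.qubits → Bool) × (AliceInput n × BobInput n m × Fin P.coins))
      ((Fin P.qubits → Bool) × (AliceInput n × BobInput n m × Fin P.coins)) ℂ :=
  Matrix.blockDiagonal fun b : AliceInput n × BobInput n m × Fin P.coins =>
    ((μ (b.1, b.2.1) * P.coin b.2.2 : ℝ) : ℂ) • P.state b.2.2 b.1

/-- The reduced state of Bob's input, the public randomness and the message: Alice's input is
traced out. -/
def stateYPi (P : QuantumProtocol n m) (μ : AliceInput n × BobInput n m → ℝ) :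
    Matrix ((Fin P.qubits → Bool) × (BobInput n m × Fin P.coins))
      ((Fin P.qubits → Bool) × (BobInput n m × Fin P.coins)) ℂ :=
  Matrix.blockDiagonal fun b : BobInput n m × Fin P.coins =>
    ∑ x, ((μ (x, b.1) * P.coin b.2 : ℝ) : ℂ) • P.state b.2 x

/-- The information cost with respect to `μ`: the conditional mutual information
`I(X : Π | Y) = H(XY) + H(ΠY) - H(XΠY) - H(Y)`, where `Π` consists of the quantum message and the
public randomness. -/
def infoCostAt (P : QuantumProtocol n m) (μ : AliceInput n × BobInput n m → ℝ) : ℝ :=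
  shannonEntropy μ + vonNeumannEntropy (P.stateYPi μ) - vonNeumannEntropy (P.stateXYPi μ)
    - shannonEntropy fun y => ∑ x, μ (x, y)

/-- The distribution-independent information cost: the supremum over all joint distributions of
the inputs. -/
def infoCost (P : QuantumProtocol n m) : ℝ :=
  sSup (P.infoCostAt '' stdSimplex ℝ (AliceInput n × BobInput n m))

end QuantumProtocol

/-- Quantum communication complexity: the least number of qubits sent by a winning quantum
protocol. -/
def quantumCC (n m : ℕ) (γ : ℝ) : ℕ :=
  sInf {q : ℕ | ∃ P : QuantumProtocol n m, P.Wins γ ∧ P.qubits = q}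

/-- Quantum information complexity: the infimum of the information costs of the winning quantum
protocols. -/
def quantumIC (n m : ℕ) (γ : ℝ) : ℝ :=
  sInf {c : ℝ | ∃ P : QuantumProtocol n m, P.Wins γ ∧ P.infoCost = c}

/-! ### Asymptotics and gaps -/

/-- `f ∈ õ(n)`: `f` is `o(n log^k n)` for every integer exponent `k`, positive or negative. -/
def SoftLittleO (f : ℕ → ℝ) : Prop :=
  ∀ k : ℤ, f =o[atTop] fun n : ℕ => (n : ℝ) * Real.log n ^ k

/-- `lim g₂ / g₁ ≥ 1`, where the limit exists and may be infinite. -/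
def LimRatioGeOne (g₁ g₂ : ℕ → ℝ) : Prop :=
  ∃ L : EReal, 1 ≤ L ∧ Tendsto (fun n => ((g₂ n / g₁ n : ℝ) : EReal)) atTop (𝓝 L)

/-- The gap between `g₁` and `g₂` is infinite: for no strictly increasing `g` is `log g₂`
asymptotically equivalent to `g (log g₁)` (their ratio tends to `1`). -/
def InfiniteGap (g₁ g₂ : ℕ → ℝ) : Prop :=
  ¬ ∃ g : ℝ → ℝ, StrictMono g ∧
    (fun n => Real.log (g₂ n)) ~[atTop] fun n => g (Real.log (g₁ n))

/-- The gap between the (eventually positive) asymptotics `g₁` and `g₂` is doubly infinite. -/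
def DoublyInfiniteGap (g₁ g₂ : ℕ → ℝ) : Prop :=
  (∀ᶠ n in atTop, 0 < g₁ n) ∧ (∀ᶠ n in atTop, 0 < g₂ n) ∧ LimRatioGeOne g₁ g₂ ∧
  ∃ gm : ℕ → ℝ, (∀ᶠ n in atTop, 0 < gm n) ∧ LimRatioGeOne gm g₂ ∧ LimRatioGeOne g₁ gm ∧
    InfiniteGap g₁ gm ∧ InfiniteGap gm g₂

/-- The gap between `g₁` and `g₂` is at most exponential: `g₂ ≤ 2 ^ O(g₁)`. -/
def AtMostExponentialGap (g₁ g₂ : ℕ → ℝ) : Prop :=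
  ∃ K : ℝ, ∀ᶠ n in atTop, g₂ n ≤ (2 : ℝ) ^ (K * g₁ n)

end Exclusion

end

/-!
# Information and communication complexity of the exclusion game

*Information, upper bound.* Alice encodes every bit in a qubit `a |0⟩ ± b |1⟩` with
`(1 + b / a) ^ m = 2`. On the `m` qubits selected by Bob, the Hadamard-type vectors
`2 ^ (-m / 2) ∑ v, ± (-1) ^ ⟨z, v⟩ |v⟩`, with sign `-1` only at `v = 0`, form an orthonormal basis
whose `z`-th member is orthogonal to the encoding of `z`: the overlap is proportional to
`(a + b) ^ m - 2 a ^ m` (`sum_amplitude_mul_character`). So Bob never errs. All messages have the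
same product distribution on the diagonal, and the diagonal has at least the entropy of the state
(`vonNeumannEntropy_le_diag`), so that the information cost is at most `n` times the binary entropy
of `b ^ 2 ≈ (log 2 / m) ^ 2`, which is `O(n m⁻² log m)` (`quantumIC_le`).

*Information, positivity.* The logarithm of the information complexity is only meaningful if the
infimum over protocols of all dimensions is positive. Each forbidden outcome has probability zero
on its own message, while on the mean message the outcome probabilities add up to one. A form of
Klein's inequality that does not depend on the dimension (`klein_effect`) turns this into a lower
bound for the Holevo information (`QuantumProtocol.le_infoCost`).

*Communication.* By Sauer–Shelah, a set of inputs that misses a pattern on every `m`-set has at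
most about `2 ^ (n / 2)` members once `12 m ≤ n`, so that any classification of the inputs into
such sets has at least `2 ^ (n / 2)` classes (`two_pow_le_card_sq`). Fixing the randomness of an
errorless classical protocol, the inputs with the same message form such a set, which gives a
linear lower bound. For a quantum protocol in dimension `d`, Carathéodory's theorem leaves a
measurement with `2 d ^ 2 + 1` outcomes, one of which has probability at least `1 / (2 d ^ 2 + 1)`
on a given message (`exists_effect_trace_ge`). The corresponding answer is therefore correct for
all messages within a distance polynomial in `1 / d`, and rounding the density matrices accordingly
gives `d ^ O(d ^ 2)` classes. Hence `d` is at least a power of `n` (`le_quantumCC`).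

*Gaps.* The constant function `1` lies between the information complexity, which tends to `0`, and
the quantum communication complexity, which tends to infinity; a strictly increasing function
cannot relate a constant to an unbounded logarithm.
-/

noncomputable section

namespace Exclusion

/-! ### Fibres that shatter no `m`-set -/

/-- A family of subsets of `[n]` shattering no set of size `m` has at most `9 ^ n / 8 ^ (n - m)`
members: by Sauer–Shelah it is at most as large as the family of sets with fewer than `m`
elements, and each of these has weight at least `8 ^ (n - m)` in `∑ s, 8 ^ (n - |s|) = 9 ^ n`. -/
lemma card_mul_le_of_not_shatters {n m : ℕ} (A : Finset (Finset (Fin n)))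
    (h : ∀ s : Finset (Fin n), s.card = m → ¬ A.Shatters s) :
    A.card * 8 ^ n ≤ 9 ^ n * 8 ^ m := by
  classical
  have h1 : ∀ s ∈ A.shatterer, s.card < m := by
    intro s hs
    by_contra hlt
    push Not at hlt
    obtain ⟨t, hts, htm⟩ := Finset.exists_subset_card_eq hlt
    exact h t htm ((Finset.mem_shatterer.1 hs).mono_right hts)
  have h2 := Finset.sum_pow_mul_eq_add_pow (1 : ℕ) 8 (Finset.univ : Finset (Fin n))
  simp only [one_pow, one_mul, Finset.card_univ, Fintype.card_fin] at h2
  calc A.card * 8 ^ n ≤ A.shatterer.card * 8 ^ n :=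
        Nat.mul_le_mul_right _ (Finset.card_le_card_shatterer A)
    _ = ∑ s ∈ A.shatterer, 8 ^ n := by simp
    _ ≤ ∑ s ∈ A.shatterer, 8 ^ (n - s.card) * 8 ^ m := by
        refine Finset.sum_le_sum fun s hs => ?_
        rw [← pow_add]
        have := h1 s hs
        exact Nat.pow_le_pow_right (by norm_num) (by omega)
    _ ≤ ∑ s ∈ (Finset.univ : Finset (Fin n)).powerset, 8 ^ (n - s.card) * 8 ^ m :=
        Finset.sum_le_sum_of_subset fun s _ => by simp
    _ = 9 ^ n * 8 ^ m := by rw [← Finset.sum_mul, h2]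

lemma sq_le_two_pow_of_mul_le {S n m : ℕ} (h : S * 8 ^ n ≤ 9 ^ n * 8 ^ m) (hm : 12 * m ≤ n) :
    S ^ 2 ≤ 2 ^ n := by
  have h1 : (S * 8 ^ n) ^ 4 ≤ (9 ^ n * 8 ^ m) ^ 4 := Nat.pow_le_pow_left h 4
  have h2 : (S ^ 2) ^ 2 * 4096 ^ n ≤ (2 ^ n) ^ 2 * 4096 ^ n := by
    calc (S ^ 2) ^ 2 * 4096 ^ n = (S * 8 ^ n) ^ 4 := by
          rw [mul_pow, ← pow_mul, ← pow_mul, mul_comm n 4, pow_mul 8]; norm_num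
      _ ≤ (9 ^ n * 8 ^ m) ^ 4 := h1
      _ = 6561 ^ n * 2 ^ (12 * m) := by
          rw [mul_pow, ← pow_mul, ← pow_mul, mul_comm n 4, mul_comm m 4, pow_mul 9, pow_mul 8,
            pow_mul 2]
          norm_num
      _ ≤ 8192 ^ n * 2 ^ n :=
          Nat.mul_le_mul (Nat.pow_le_pow_left (by norm_num) n)
            (Nat.pow_le_pow_right (by norm_num) hm)
      _ = (2 ^ n) ^ 2 * 4096 ^ n := by
          rw [← mul_pow, ← pow_mul, mul_comm n 2, pow_mul, ← mul_pow]; norm_num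
  exact (Nat.pow_le_pow_iff_left (by norm_num)).1 (Nat.le_of_mul_le_mul_right h2 (by positivity))

/-- If the inputs are classified so that, for every class and every `y` of size `m`, some string
is not the restriction to `y` of any member of the class, then there are at least `2 ^ (n / 2)`
classes. This is the common source of both communication lower bounds. -/
lemma two_pow_le_card_sq {n m : ℕ} {κ : Type*} [Fintype κ] (hm : 12 * m ≤ n)
    (f : AliceInput n → κ)
    (h : ∀ (c : κ) (y : BobInput n m), ∃ z : Answer m, ∀ x, f x = c → restrict x y ≠ z) :
    2 ^ n ≤ Fintype.card κ ^ 2 := by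
  classical
  let T : AliceInput n → Finset (Fin n) := fun x => Finset.univ.filter fun i => x i = true
  have hT : Function.Injective T := by
    intro x x' hxx
    funext i
    have h1 : i ∈ T x ↔ i ∈ T x' := by rw [hxx]
    simp only [T, Finset.mem_filter, Finset.mem_univ, true_and] at h1
    exact Bool.eq_iff_iff.2 h1
  have hfib : ∀ c : κ, ((Finset.univ.filter fun x => f x = c).card) ^ 2 ≤ 2 ^ n := by
    intro c
    rw [← Finset.card_image_of_injective _ hT]
    refine sq_le_two_pow_of_mul_le (card_mul_le_of_not_shatters (m := m) _ ?_) hm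
    intro s hs hsh
    obtain ⟨z, hz⟩ := h c ⟨s, hs⟩
    have htsub : (Finset.univ.filter fun j => z j = true).image (s.orderEmbOfFin hs) ⊆ s := by
      intro i hi
      obtain ⟨j, -, rfl⟩ := Finset.mem_image.1 hi
      exact Finset.orderEmbOfFin_mem s hs j
    obtain ⟨u, hu, hsu⟩ := hsh htsub
    obtain ⟨x, hx, rfl⟩ := Finset.mem_image.1 hu
    refine hz x (by simpa using hx) ?_
    funext j
    have h1 : s.orderEmbOfFin hs j ∈ s ∩ T x ↔ z j = true := by
      rw [hsu]; simp
    have h2 : s.orderEmbOfFin hs j ∈ s := Finset.orderEmbOfFin_mem s hs j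
    rw [Finset.mem_inter] at h1
    simp only [h2, true_and, T, Finset.mem_filter, Finset.mem_univ] at h1
    exact Bool.eq_iff_iff.2 h1
  have hsum : 2 ^ n = ∑ c : κ, (Finset.univ.filter fun x => f x = c).card := by
    have h1 := Finset.card_eq_sum_card_fiberwise (f := f) (s := Finset.univ) (t := Finset.univ)
      fun x _ => Finset.mem_coe.2 (Finset.mem_univ _)
    simpa using h1
  have h3 : (2 ^ n) ^ 2 ≤ Fintype.card κ ^ 2 * 2 ^ n := by
    calc (2 ^ n) ^ 2 = (∑ c : κ, (Finset.univ.filter fun x => f x = c).card) ^ 2 := by rw [← hsum]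
      _ ≤ Fintype.card κ * ∑ c : κ, (Finset.univ.filter fun x => f x = c).card ^ 2 :=
          sq_sum_le_card_mul_sum_sq
      _ ≤ Fintype.card κ * ∑ c : κ, 2 ^ n := by
          exact Nat.mul_le_mul_left _ (Finset.sum_le_sum fun c _ => hfib c)
      _ = Fintype.card κ ^ 2 * 2 ^ n := by simp; ring
  rw [sq (2 ^ n)] at h3
  exact Nat.le_of_mul_le_mul_right h3 (by positivity)

/-! ### Errorless protocols -/

lemma bobInput_nonempty {n m : ℕ} (h : m ≤ n) : Nonempty (BobInput n m) := by
  obtain ⟨t, -, ht⟩ := Finset.exists_subset_card_eq (s := (Finset.univ : Finset (Fin n))) (n := m)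
    (by simpa using h)
  exact ⟨⟨t, ht⟩⟩

lemma eq_zero_of_uniformAverage_le_zero {n m : ℕ} (h : m ≤ n)
    (f : AliceInput n → BobInput n m → ℝ) (hf : ∀ x y, 0 ≤ f x y) (h0 : uniformAverage f ≤ 0)
    (x : AliceInput n) (y : BobInput n m) : f x y = 0 := by
  have := bobInput_nonempty h
  have hpos : (0 : ℝ) < Fintype.card (AliceInput n) * Fintype.card (BobInput n m) := by
    have : 0 < Fintype.card (AliceInput n) * Fintype.card (BobInput n m) :=
      Nat.mul_pos Fintype.card_pos Fintype.card_pos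
    exact_mod_cast this
  have h1 : ∑ x, ∑ y, f x y ≤ 0 := by
    unfold uniformAverage at h0
    by_contra hc
    push Not at hc
    exact absurd (div_pos hc hpos) (not_lt.2 h0)
  have h2 : ∑ x, ∑ y, f x y = 0 :=
    le_antisymm h1 (Finset.sum_nonneg fun x _ => Finset.sum_nonneg fun y _ => hf x y)
  have h3 := (Finset.sum_eq_zero_iff_of_nonneg
    (fun x _ => Finset.sum_nonneg fun y _ => hf x y)).1 h2 x (Finset.mem_univ _)
  exact (Finset.sum_eq_zero_iff_of_nonneg (fun y _ => hf x y)).1 h3 y (Finset.mem_univ _)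

lemma exists_pos_of_mem_stdSimplex {ι : Type*} [Fintype ι] {p : ι → ℝ}
    (hp : p ∈ stdSimplex ℝ ι) : ∃ i, 0 < p i := by
  by_contra hc
  push Not at hc
  have := Finset.sum_nonpos fun i (_ : i ∈ Finset.univ) => hc i
  rw [hp.2] at this
  norm_num at this

/-! ### Classical communication -/

lemma uniformAverage_zero {n m : ℕ} {f : AliceInput n → BobInput n m → ℝ}
    (hf : ∀ x y, f x y = 0) : uniformAverage f = 0 := by
  simp [uniformAverage, hf]

/-- The string that differs from `z` in every position. -/
def complement {m : ℕ} (z : Answer m) : Answer m := fun j => !(z j)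

lemma complement_ne {m : ℕ} (hm : 1 ≤ m) (z : Answer m) : complement z ≠ z := by
  intro h
  have := congrFun h ⟨0, hm⟩
  simp [complement] at this

/-- Alice sends her whole input, and Bob complements its restriction. -/
lemma exists_classicalProtocol {n m : ℕ} (hm : 1 ≤ m) :
    ∃ P : ClassicalProtocol n m, P.Wins 0 ∧ P.CostAtMost n := by
  refine ⟨⟨1, fun _ => 1, ⟨fun _ => zero_le_one, by simp⟩, fun _ x => PMF.pure (List.ofFn x),
    fun _ y w => PMF.pure (complement (restrict (fun i : Fin n => w.getD i false) y))⟩, ?_, ?_⟩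
  · refine (uniformAverage_zero fun x y => ?_).le
    have hx : (fun i : Fin n => (List.ofFn x).getD i false) = x := by
      funext i
      simp [List.getD_eq_getElem?_getD]
    simp only [ClassicalProtocol.errorProb, PMF.pure_bind, hx]
    simp [PMF.pure_apply, (complement_ne hm (restrict x y)).symm]
  · intro r x w hw
    rw [PMF.support_pure, Set.mem_singleton_iff] at hw
    simp [hw]

lemma le_four_mul_of_wins {n m c : ℕ} (hn : 12 * m ≤ n) (P : ClassicalProtocol n m)
    (hP : P.Wins 0) (hc : P.CostAtMost c) : n ≤ 4 * c := by
  obtain ⟨r, hr⟩ := exists_pos_of_mem_stdSimplex P.coin_mem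
  have herr : ∀ x y, P.errorProb x y = 0 := by
    refine eq_zero_of_uniformAverage_le_zero (by omega) _ (fun x y => ?_) hP
    exact Finset.sum_nonneg fun r _ => mul_nonneg (P.coin_mem.1 r) ENNReal.toReal_nonneg
  have hnot : ∀ x y, restrict x y ∉ ((P.message r x).bind (P.answer r y)).support := by
    intro x y
    have h1 := (Finset.sum_eq_zero_iff_of_nonneg fun r _ =>
      mul_nonneg (P.coin_mem.1 r) ENNReal.toReal_nonneg).1 (herr x y) r (Finset.mem_univ _)
    have h2 := (mul_eq_zero.1 h1).resolve_left hr.ne'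
    rw [ENNReal.toReal_eq_zero_iff] at h2
    rw [PMF.mem_support_iff, not_not]
    exact h2.resolve_right (PMF.apply_ne_top _ _)
  choose w hw using fun x => (P.message r x).support_nonempty
  have hlen : ∀ x, (w x).length < c + 1 := fun x => Nat.lt_succ_of_le (hc r x _ (hw x))
  let f : AliceInput n → Fin (c + 1) × (Fin c → Bool) := fun x =>
    (⟨(w x).length, hlen x⟩, fun i => (w x).getD i false)
  have hf : ∀ x x', f x = f x' → w x = w x' := by
    intro x x' h
    have h1 : (w x).length = (w x').length := congrArg (fun p => (p.1 : ℕ)) h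
    have h2 : ∀ i : Fin c, (w x).getD i false = (w x').getD i false :=
      fun i => congrFun (congrArg Prod.snd h) i
    refine List.ext_getElem h1 fun i hi hi' => ?_
    have := h2 ⟨i, by have := hlen x; omega⟩
    simpa [List.getD_eq_getElem?_getD, hi, hi'] using this
  have key := two_pow_le_card_sq hn f ?_
  · have h3 : c + 1 ≤ 2 ^ c := Nat.lt_two_pow_self
    have h4 : 2 ^ n ≤ 2 ^ (4 * c) := by
      refine key.trans ?_
      simp only [Fintype.card_prod, Fintype.card_fin, Fintype.card_fun, Fintype.card_bool]
      calc ((c + 1) * 2 ^ c) ^ 2 ≤ (2 ^ c * 2 ^ c) ^ 2 := by gcongr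
        _ = 2 ^ (4 * c) := by rw [← pow_add, ← pow_mul]; congr 1; ring
    exact (Nat.pow_le_pow_iff_right (by norm_num)).1 h4
  · intro k y
    by_cases hk : ∃ x₀, f x₀ = k
    · obtain ⟨x₀, hx₀⟩ := hk
      obtain ⟨z, hz⟩ := (P.answer r y (w x₀)).support_nonempty
      refine ⟨z, fun x hx hxz => hnot x y ?_⟩
      rw [PMF.mem_support_bind_iff]
      exact ⟨w x, hw x, by rw [hf x x₀ (hx.trans hx₀.symm), hxz]; exact hz⟩
    · exact ⟨fun _ => false, fun x hx => absurd ⟨x, hx⟩ hk⟩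

lemma classicalCC_le {n m : ℕ} (hm : 1 ≤ m) : classicalCC n m 0 ≤ n :=
  Nat.sInf_le (exists_classicalProtocol hm)

lemma le_four_mul_classicalCC {n m : ℕ} (hm : 1 ≤ m) (hn : 12 * m ≤ n) :
    n ≤ 4 * classicalCC n m 0 := by
  obtain ⟨P, hP, hc⟩ := Nat.sInf_mem (s := {c : ℕ | ∃ P : ClassicalProtocol n m,
    P.Wins 0 ∧ P.CostAtMost c}) ⟨n, exists_classicalProtocol hm⟩
  exact le_four_mul_of_wins hn P hP hc

open Matrix

/-! ### Von Neumann entropy and Klein's inequality -/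

section Spectral

variable {ι : Type*} [Fintype ι] [DecidableEq ι]

lemma vonNeumannEntropy_eq {A : Matrix ι ι ℂ} (hA : A.IsHermitian) :
    vonNeumannEntropy A = shannonEntropy hA.eigenvalues := by
  simp [vonNeumannEntropy, hA]

lemma vonNeumannEntropy_conj_diagonal (U : Matrix ι ι ℂ) (hU : U * Uᴴ = 1) (d : ι → ℝ) :
    vonNeumannEntropy (U * diagonal (fun i => (d i : ℂ)) * Uᴴ) = shannonEntropy d := by
  have hA : (U * diagonal (fun i => (d i : ℂ)) * Uᴴ).IsHermitian := by
    refine isHermitian_mul_mul_conjTranspose U ?_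
    rw [Matrix.isHermitian_diagonal_iff]
    intro i
    simp [IsSelfAdjoint]
  rw [vonNeumannEntropy_eq hA, shannonEntropy, shannonEntropy]
  congr 1
  have h1 : (U * diagonal (fun i => (d i : ℂ)) * Uᴴ).charpoly
      = ∏ i, (Polynomial.X - Polynomial.C (d i : ℂ)) := by
    rw [charpoly_mul_comm, ← mul_assoc, mul_eq_one_comm.1 hU, one_mul, charpoly_diagonal]
  have h2 := hA.roots_charpoly_eq_eigenvalues
  rw [h1, Polynomial.roots_prod _ _
    (Finset.prod_ne_zero_iff.2 fun i _ => Polynomial.X_sub_C_ne_zero _)] at h2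
  have h3 := congrArg (fun s => (s.map fun z : ℂ => Real.negMulLog z.re).sum) h2
  simpa using h3.symm

/-- The spectral theorem, with explicit adjoints. -/
lemma spectral_eq {A : Matrix ι ι ℂ} (hA : A.IsHermitian) :
    A = (hA.eigenvectorUnitary : Matrix ι ι ℂ) * diagonal (fun i => (hA.eigenvalues i : ℂ))
      * (hA.eigenvectorUnitary : Matrix ι ι ℂ)ᴴ := by
  conv_lhs => rw [hA.spectral_theorem, Unitary.conjStarAlgAut_apply]
  rfl

lemma eigenvectorUnitary_mul_conjTranspose {A : Matrix ι ι ℂ} (hA : A.IsHermitian) :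
    (hA.eigenvectorUnitary : Matrix ι ι ℂ) * (hA.eigenvectorUnitary : Matrix ι ι ℂ)ᴴ = 1 :=
  Unitary.coe_mul_star_self hA.eigenvectorUnitary

lemma conjTranspose_mul_eigenvectorUnitary {A : Matrix ι ι ℂ} (hA : A.IsHermitian) :
    (hA.eigenvectorUnitary : Matrix ι ι ℂ)ᴴ * (hA.eigenvectorUnitary : Matrix ι ι ℂ) = 1 :=
  Unitary.coe_star_mul_self hA.eigenvectorUnitary

lemma vonNeumannEntropy_blockDiagonal {β : Type*} [Fintype β] [DecidableEq β]
    (A : β → Matrix ι ι ℂ) (hA : ∀ b, (A b).IsHermitian) :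
    vonNeumannEntropy (blockDiagonal A) = ∑ b, vonNeumannEntropy (A b) := by
  have h1 : blockDiagonal A
      = blockDiagonal (fun b => ((hA b).eigenvectorUnitary : Matrix ι ι ℂ))
        * diagonal (fun i : ι × β => ((hA i.2).eigenvalues i.1 : ℂ))
        * (blockDiagonal (fun b => ((hA b).eigenvectorUnitary : Matrix ι ι ℂ)))ᴴ := by
    rw [blockDiagonal_conjTranspose, ← blockDiagonal_diagonal
      (fun b i => ((hA b).eigenvalues i : ℂ)), ← blockDiagonal_mul, ← blockDiagonal_mul]
    congr 1
    funext b
    exact spectral_eq (hA b)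
  rw [h1, vonNeumannEntropy_conj_diagonal]
  · simp only [vonNeumannEntropy_eq (hA _), shannonEntropy, Fintype.sum_prod_type_right,
      Finset.sum_div]
  · rw [blockDiagonal_conjTranspose, ← blockDiagonal_mul, ← blockDiagonal_one]
    congr 1
    funext b
    exact eigenvectorUnitary_mul_conjTranspose (hA b)

lemma sum_eigenvalues_eq_one {A : Matrix ι ι ℂ} (hA : A.IsHermitian) (ht : A.trace = 1) :
    ∑ i, hA.eigenvalues i = 1 := by
  have h := hA.trace_eq_sum_eigenvalues
  rw [ht] at h
  have h2 : ((∑ i, hA.eigenvalues i : ℝ) : ℂ) = 1 := by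
    rw [h]
    push_cast
    rfl
  exact_mod_cast h2

lemma vonNeumannEntropy_smul {A : Matrix ι ι ℂ} (hA : A.IsHermitian) (ht : A.trace = 1) (c : ℝ) :
    vonNeumannEntropy ((c : ℂ) • A)
      = Real.negMulLog c / Real.log 2 + c * vonNeumannEntropy A := by
  have h1 : (c : ℂ) • A = (hA.eigenvectorUnitary : Matrix ι ι ℂ)
      * diagonal (fun i => ((c * hA.eigenvalues i : ℝ) : ℂ))
      * (hA.eigenvectorUnitary : Matrix ι ι ℂ)ᴴ := by
    conv_lhs => rw [spectral_eq hA]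
    rw [← Matrix.smul_mul, ← Matrix.mul_smul, ← diagonal_smul]
    congr 3
    funext i
    simp
  rw [h1, vonNeumannEntropy_conj_diagonal _ (eigenvectorUnitary_mul_conjTranspose hA),
    vonNeumannEntropy_eq hA, shannonEntropy, shannonEntropy]
  simp only [Real.negMulLog_mul, Finset.sum_add_distrib, ← Finset.sum_mul, ← Finset.mul_sum,
    sum_eigenvalues_eq_one hA ht]
  ring

lemma conj_diagonal_apply (M : Matrix ι ι ℂ) (d : ι → ℝ) (j : ι) :
    (Mᴴ * diagonal (fun i => (d i : ℂ)) * M) j j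
      = ((∑ i, Complex.normSq (M i j) * d i : ℝ) : ℂ) := by
  rw [Matrix.mul_apply]
  push_cast
  refine Finset.sum_congr rfl fun i _ => ?_
  rw [Matrix.mul_diagonal, conjTranspose_apply, Complex.normSq_eq_conj_mul_self]
  simp only [RCLike.star_def]
  ring

/-- Diagonal entries of a Hermitian matrix in another basis are averages of its eigenvalues. -/
lemma conj_apply_self {A : Matrix ι ι ℂ} (hA : A.IsHermitian) (B : Matrix ι ι ℂ) (j : ι) :
    (Bᴴ * A * B) j j = ((∑ i, Complex.normSq
      (((hA.eigenvectorUnitary : Matrix ι ι ℂ)ᴴ * B) i j) * hA.eigenvalues i : ℝ) : ℂ) := by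
  rw [← conj_diagonal_apply]
  conv_lhs => rw [spectral_eq hA]
  simp only [conjTranspose_mul, conjTranspose_conjTranspose, mul_assoc]

lemma sum_normSq_col {U : Matrix ι ι ℂ} (hU : Uᴴ * U = 1) (j : ι) :
    ∑ i, Complex.normSq (U i j) = 1 := by
  have h := congrFun (congrFun hU j) j
  rw [Matrix.mul_apply, one_apply_eq] at h
  have h2 : ((∑ i, Complex.normSq (U i j) : ℝ) : ℂ) = 1 := by
    rw [← h]
    push_cast
    refine Finset.sum_congr rfl fun i _ => ?_
    rw [conjTranspose_apply, Complex.normSq_eq_conj_mul_self]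
    rfl
  exact_mod_cast h2

lemma sum_normSq_row {U : Matrix ι ι ℂ} (hU : U * Uᴴ = 1) (i : ι) :
    ∑ j, Complex.normSq (U i j) = 1 := by
  have := sum_normSq_col (U := Uᴴ) (by rwa [conjTranspose_conjTranspose]) i
  simpa using this

/-- Measuring in the standard basis does not decrease the entropy. -/
lemma vonNeumannEntropy_le_diag {A : Matrix ι ι ℂ} (hA : A.PosSemidef) :
    vonNeumannEntropy A ≤ shannonEntropy fun i => (A i i).re := by
  rw [vonNeumannEntropy_eq hA.1, shannonEntropy, shannonEntropy]
  refine div_le_div_of_nonneg_right ?_ (Real.log_nonneg (by norm_num))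
  set W : ι → ι → ℝ := fun i j =>
    Complex.normSq (((hA.1.eigenvectorUnitary : Matrix ι ι ℂ)ᴴ) i j) with hW
  have hcol : ∀ j, ∑ i, W i j = 1 := sum_normSq_col (by
    rw [conjTranspose_conjTranspose]; exact eigenvectorUnitary_mul_conjTranspose hA.1)
  have hrow : ∀ i, ∑ j, W i j = 1 := sum_normSq_row (by
    rw [conjTranspose_conjTranspose]; exact conjTranspose_mul_eigenvectorUnitary hA.1)
  have hdiag : ∀ j, (A j j).re = ∑ i, W i j * hA.1.eigenvalues i := by
    intro j
    have := conj_apply_self hA.1 1 j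
    simp only [conjTranspose_one, one_mul, mul_one] at this
    rw [this, Complex.ofReal_re]
  calc ∑ i, Real.negMulLog (hA.1.eigenvalues i)
      = ∑ j, ∑ i, W i j * Real.negMulLog (hA.1.eigenvalues i) := by
        rw [Finset.sum_comm]
        refine Finset.sum_congr rfl fun i _ => ?_
        rw [← Finset.sum_mul, hrow, one_mul]
    _ ≤ ∑ j, Real.negMulLog (A j j).re := by
        refine Finset.sum_le_sum fun j _ => ?_
        rw [hdiag]
        have := Real.concaveOn_negMulLog.le_map_sum (t := Finset.univ) (w := fun i => W i j)
          (p := hA.1.eigenvalues) (fun i _ => Complex.normSq_nonneg _) (hcol j)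
          (fun i _ => hA.eigenvalues_nonneg i)
        simpa using this

lemma trace_mul_eq_sum {A : Matrix ι ι ℂ} (hA : A.IsHermitian) (E : Matrix ι ι ℂ) :
    (A * E).trace.re = ∑ i, hA.eigenvalues i *
      (((hA.eigenvectorUnitary : Matrix ι ι ℂ)ᴴ * E * hA.eigenvectorUnitary) i i).re := by
  have : (A * E).trace = ∑ i, (hA.eigenvalues i : ℂ) *
      ((hA.eigenvectorUnitary : Matrix ι ι ℂ)ᴴ * E * hA.eigenvectorUnitary) i i := by
    conv_lhs => rw [spectral_eq hA]
    rw [mul_assoc, mul_assoc, trace_mul_comm, mul_assoc, trace]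
    refine Finset.sum_congr rfl fun i _ => ?_
    rw [diag_apply, diagonal_mul]
  rw [this, Complex.re_sum]
  simp

lemma trace_mul_re_nonneg {A E : Matrix ι ι ℂ} (hA : A.PosSemidef) (hE : E.PosSemidef) :
    0 ≤ (A * E).trace.re := by
  rw [trace_mul_eq_sum hA.1]
  exact Finset.sum_nonneg fun i _ => mul_nonneg (hA.eigenvalues_nonneg i)
    (Complex.le_def.1 (hE.conjTranspose_mul_mul_same _).diag_nonneg).1

lemma klein_term (p q : ℝ) (hp : 0 ≤ p) (hq : 0 < q) :
    0 ≤ p * Real.log p - p * Real.log q - p + q := by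
  rcases hp.eq_or_lt with rfl | hp
  · simpa using hq.le
  · have h := Real.log_le_sub_one_of_pos (div_pos hq hp)
    rw [Real.log_div hq.ne' hp.ne'] at h
    have h2 := mul_le_mul_of_nonneg_left h hp.le
    have h3 : p * (q / p - 1) = q - p := by field_simp
    nlinarith

/-- An effect that never fires on `ρ` is bounded by the projection onto the kernel of `ρ`. -/
lemma conj_effect_le {ρ E : Matrix ι ι ℂ} (hρ : ρ.PosSemidef) (hE : E.PosSemidef)
    (hE1 : (1 - E).PosSemidef) (h0 : (ρ * E).trace.re = 0) (V : Matrix ι ι ℂ) (j : ι) :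
    ((Vᴴ * E * V) j j).re ≤ ∑ i, if hρ.1.eigenvalues i = 0 then
      Complex.normSq (((hρ.1.eigenvectorUnitary : Matrix ι ι ℂ)ᴴ * V) i j) else 0 := by
  set U : Matrix ι ι ℂ := (hρ.1.eigenvectorUnitary : Matrix ι ι ℂ) with hU
  set p := hρ.1.eigenvalues with hp
  have hUU : U * Uᴴ = 1 := eigenvectorUnitary_mul_conjTranspose hρ.1
  set C := Uᴴ * E * U with hC
  have hCpos : C.PosSemidef := hE.conjTranspose_mul_mul_same U
  have hC1 : (1 - C).PosSemidef := by
    have := hE1.conjTranspose_mul_mul_same U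
    rwa [mul_sub, sub_mul, mul_one, mul_eq_one_comm.1 hUU] at this
  have htr : ∑ i, p i * (C i i).re = 0 := by rw [← h0, trace_mul_eq_sum hρ.1]
  have hdiag : ∀ i, p i ≠ 0 → C i i = 0 := by
    intro i hi
    have hnn : ∀ i, 0 ≤ C i i := fun i => hCpos.diag_nonneg
    have h1 := (Finset.sum_eq_zero_iff_of_nonneg fun i _ =>
      mul_nonneg (hρ.eigenvalues_nonneg i) (Complex.le_def.1 (hnn i)).1).1 htr i (Finset.mem_univ i)
    have h2 := (mul_eq_zero.1 h1).resolve_left hi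
    exact Complex.ext h2 (Complex.le_def.1 (hnn i)).2.symm
  have hcol : ∀ i k, p i ≠ 0 → C k i = 0 := by
    intro i k hi
    have h1 : star (Pi.single i (1 : ℂ)) ⬝ᵥ (C *ᵥ Pi.single i 1) = 0 := by
      simp [hdiag i hi]
    have h2 := (hCpos.dotProduct_mulVec_zero_iff _).1 h1
    simpa using congrFun h2 k
  have hrow : ∀ i k, p i ≠ 0 → C i k = 0 := by
    intro i k hi
    have := hCpos.1.apply i k
    rw [← this, hcol i k hi, star_zero]
  set M := Uᴴ * V with hM
  set u : ι → ℂ := fun i => if p i = 0 then M i j else 0 with hu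
  have h1 : (Vᴴ * E * V) j j = star u ⬝ᵥ (C *ᵥ u) := by
    have h2 : Vᴴ * E * V = Mᴴ * C * M := by
      have : Mᴴ * C * M = Vᴴ * (U * Uᴴ) * E * (U * Uᴴ) * V := by
        simp only [hM, hC, conjTranspose_mul, conjTranspose_conjTranspose, mul_assoc]
      rw [this, hUU, mul_one, mul_one]
    rw [h2, mul_assoc, Matrix.mul_apply]
    simp only [dotProduct, mulVec, Matrix.mul_apply]
    refine Finset.sum_congr rfl fun i _ => ?_
    by_cases hi : p i = 0
    · have hk : ∀ k, C i k * M k j = C i k * u k := by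
        intro k
        by_cases hk : p k = 0
        · simp [hu, hk]
        · simp [hcol k i hk]
      have hui : u i = M i j := if_pos hi
      rw [Pi.star_apply, hui, conjTranspose_apply, Finset.sum_congr rfl fun k _ => hk k]
    · simp [hrow i _ hi]
  have h2 : 0 ≤ (star u ⬝ᵥ ((1 - C) *ᵥ u)).re := hC1.re_dotProduct_nonneg u
  rw [sub_mulVec, one_mulVec, dotProduct_sub, Complex.sub_re] at h2
  rw [h1]
  refine (sub_nonneg.1 h2).trans_eq ?_
  rw [dotProduct, Complex.re_sum]
  refine Finset.sum_congr rfl fun i _ => ?_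
  by_cases hi : p i = 0
  · simp [hu, hi, Complex.normSq_apply]
  · simp [hu, hi]

/-- A form of Klein's inequality: the relative entropy `tr ρ log ρ - tr ρ log σ` is at least the
weight that `σ` gives to an effect `E` excluded by `ρ`. The trace `tr ρ log σ` is written in an
eigenbasis of `σ`, and the hypothesis `hsupp` says that the support of `σ` contains that of `ρ`. -/
lemma klein_effect {ρ σ E : Matrix ι ι ℂ} (hρ : ρ.PosSemidef) (hσ : σ.PosSemidef)
    (hρt : ρ.trace = 1) (hσt : σ.trace = 1) (hE : E.PosSemidef)
    (hE1 : (1 - E).PosSemidef) (h0 : (ρ * E).trace.re = 0)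
    (hsupp : ∀ j, hσ.1.eigenvalues j = 0 → (((hσ.1.eigenvectorUnitary : Matrix ι ι ℂ)ᴴ * ρ *
      (hσ.1.eigenvectorUnitary : Matrix ι ι ℂ)) j j).re = 0) :
    (σ * E).trace.re ≤ -∑ i, Real.negMulLog (hρ.1.eigenvalues i)
      - ∑ j, Real.log (hσ.1.eigenvalues j) * (((hσ.1.eigenvectorUnitary : Matrix ι ι ℂ)ᴴ * ρ *
      (hσ.1.eigenvectorUnitary : Matrix ι ι ℂ)) j j).re := by
  set U : Matrix ι ι ℂ := (hρ.1.eigenvectorUnitary : Matrix ι ι ℂ) with hU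
  set V : Matrix ι ι ℂ := (hσ.1.eigenvectorUnitary : Matrix ι ι ℂ) with hV
  set p := hρ.1.eigenvalues with hp
  set q := hσ.1.eigenvalues with hq
  have hUU : U * Uᴴ = 1 := eigenvectorUnitary_mul_conjTranspose hρ.1
  have hVV : V * Vᴴ = 1 := eigenvectorUnitary_mul_conjTranspose hσ.1
  have hMM : (Uᴴ * V)ᴴ * (Uᴴ * V) = 1 := by
    have : (Uᴴ * V)ᴴ * (Uᴴ * V) = Vᴴ * (U * Uᴴ) * V := by
      simp only [conjTranspose_mul, conjTranspose_conjTranspose, mul_assoc]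
    rw [this, hUU, mul_one, mul_eq_one_comm.1 hVV]
  set W : ι → ι → ℝ := fun i j => Complex.normSq ((Uᴴ * V) i j) with hW
  have hW0 : ∀ i j, 0 ≤ W i j := fun i j => Complex.normSq_nonneg _
  have hcol : ∀ j, ∑ i, W i j = 1 := sum_normSq_col hMM
  have hrow : ∀ i, ∑ j, W i j = 1 := sum_normSq_row (mul_eq_one_comm.1 hMM)
  have hρdiag : ∀ j, ((Vᴴ * ρ * V) j j).re = ∑ i, W i j * p i := by
    intro j
    rw [conj_apply_self hρ.1 V j, Complex.ofReal_re]
  have hp0 : ∀ i, 0 ≤ p i := hρ.eigenvalues_nonneg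
  have hq0 : ∀ j, 0 ≤ q j := hσ.eigenvalues_nonneg
  have hp1 : ∑ i, p i = 1 := sum_eigenvalues_eq_one hρ.1 hρt
  have hq1 : ∑ j, q j = 1 := sum_eigenvalues_eq_one hσ.1 hσt
  have hterm : ∀ i j, (if p i = 0 then W i j * q j else 0) ≤
      W i j * (p i * Real.log (p i) - p i * Real.log (q j) - p i + q j) := by
    intro i j
    split_ifs with hi
    · simp [hi]
    · rcases (hq0 j).eq_or_lt with hj | hj
      · have h1 := hsupp j hj.symm
        rw [hρdiag] at h1
        have h2 := (Finset.sum_eq_zero_iff_of_nonneg fun i _ =>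
          mul_nonneg (hW0 i j) (hp0 i)).1 h1 i (Finset.mem_univ i)
        rw [(mul_eq_zero.1 h2).resolve_right hi]
        simp
      · exact mul_nonneg (hW0 i j) (klein_term _ _ (hp0 i) hj)
  have htr : (σ * E).trace.re = ∑ j, q j * ((Vᴴ * E * V) j j).re := trace_mul_eq_sum hσ.1 E
  calc (σ * E).trace.re = ∑ j, q j * ((Vᴴ * E * V) j j).re := htr
    _ ≤ ∑ j, q j * ∑ i, if p i = 0 then W i j else 0 :=
        Finset.sum_le_sum fun j _ => mul_le_mul_of_nonneg_left
          (conj_effect_le hρ hE hE1 h0 V j) (hq0 j)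
    _ = ∑ j, ∑ i, if p i = 0 then W i j * q j else 0 := by
        refine Finset.sum_congr rfl fun j _ => ?_
        rw [Finset.mul_sum]
        refine Finset.sum_congr rfl fun i _ => ?_
        split_ifs <;> ring
    _ ≤ ∑ j, ∑ i, W i j * (p i * Real.log (p i) - p i * Real.log (q j) - p i + q j) :=
        Finset.sum_le_sum fun j _ => Finset.sum_le_sum fun i _ => hterm i j
    _ = ∑ i, p i * Real.log (p i) - ∑ j, Real.log (q j) * ∑ i, W i j * p i - 1 + 1 := by
        have e1 : ∑ j, ∑ i, W i j * (p i * Real.log (p i)) = ∑ i, p i * Real.log (p i) := by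
          rw [Finset.sum_comm]
          refine Finset.sum_congr rfl fun i _ => ?_
          rw [← Finset.sum_mul, hrow, one_mul]
        have e2 : ∑ j, ∑ i, W i j * p i = 1 := by
          rw [Finset.sum_comm, ← hp1]
          refine Finset.sum_congr rfl fun i _ => ?_
          rw [← Finset.sum_mul, hrow, one_mul]
        have e3 : ∑ j, ∑ i, W i j * q j = 1 := by
          rw [← hq1]
          refine Finset.sum_congr rfl fun j _ => ?_
          rw [← Finset.sum_mul, hcol, one_mul]
        have e4 : ∑ j, ∑ i, W i j * (p i * Real.log (q j))
            = ∑ j, Real.log (q j) * ∑ i, W i j * p i := by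
          refine Finset.sum_congr rfl fun j _ => ?_
          rw [Finset.mul_sum]
          exact Finset.sum_congr rfl fun i _ => by ring
        simp only [mul_add, mul_sub, Finset.sum_add_distrib, Finset.sum_sub_distrib]
        rw [e1, e2, e3, e4]
    _ = _ := by
        simp only [hρdiag, Real.negMulLog, neg_mul, Finset.sum_neg_distrib, neg_neg]
        ring

/-- The Holevo information of finitely many equiprobable states is bounded below by the weights
that their mean gives to effects excluded by the individual states. -/
lemma sum_effect_le_holevo {κ : Type*} [Fintype κ] [Nonempty κ] (ρ E : κ → Matrix ι ι ℂ)
    (hρ : ∀ x, (ρ x).PosSemidef) (hρt : ∀ x, (ρ x).trace = 1) (hE : ∀ x, (E x).PosSemidef)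
    (hE1 : ∀ x, (1 - E x).PosSemidef) (h0 : ∀ x, (ρ x * E x).trace.re = 0)
    {σ : Matrix ι ι ℂ} (hσ : (Fintype.card κ : ℂ) • σ = ∑ x, ρ x) :
    ∑ x, (σ * E x).trace.re ≤ Real.log 2 *
      (Fintype.card κ * vonNeumannEntropy σ - ∑ x, vonNeumannEntropy (ρ x)) := by
  have hN : (Fintype.card κ : ℂ) ≠ 0 := by exact_mod_cast Fintype.card_ne_zero
  have hσ' : σ = (Fintype.card κ : ℂ)⁻¹ • ∑ x, ρ x := by
    rw [← hσ, smul_smul, inv_mul_cancel₀ hN, one_smul]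
  have hσp : σ.PosSemidef := by
    rw [hσ']
    refine (posSemidef_sum _ fun x _ => hρ x).smul ?_
    rw [inv_nonneg]
    exact Nat.cast_nonneg _
  have hσt : σ.trace = 1 := by
    rw [hσ', trace_smul, trace_sum]
    simp [hρt, hN]
  set V : Matrix ι ι ℂ := (hσp.1.eigenvectorUnitary : Matrix ι ι ℂ) with hV
  set q := hσp.1.eigenvalues with hq
  have hdiag : ∀ j, ∑ x, ((Vᴴ * ρ x * V) j j).re = Fintype.card κ * q j := by
    intro j
    have h1 : Vᴴ * σ * V = diagonal (fun i => (q i : ℂ)) := by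
      have hVV : Vᴴ * V = 1 := conjTranspose_mul_eigenvectorUnitary hσp.1
      have hs := spectral_eq hσp.1
      have : Vᴴ * (V * diagonal (fun i => (q i : ℂ)) * Vᴴ) * V
          = (Vᴴ * V) * diagonal (fun i => (q i : ℂ)) * (Vᴴ * V) := by
        simp only [mul_assoc]
      rw [hVV, one_mul, mul_one] at this
      rw [← this]
      congr 2
    have h2 : (Fintype.card κ : ℂ) • (Vᴴ * σ * V) = ∑ x, Vᴴ * ρ x * V := by
      rw [← Finset.sum_mul, ← Finset.mul_sum, ← hσ, Matrix.mul_smul, Matrix.smul_mul]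
    rw [h1] at h2
    have h3 := congrArg Complex.re (congrFun (congrFun h2 j) j)
    rw [Matrix.sum_apply, Complex.re_sum] at h3
    rw [← h3]
    simp
  have hnn : ∀ x j, 0 ≤ ((Vᴴ * ρ x * V) j j).re := fun x j =>
    (Complex.le_def.1 ((hρ x).conjTranspose_mul_mul_same V).diag_nonneg).1
  have key := Finset.sum_le_sum fun x (_ : x ∈ (Finset.univ : Finset κ)) =>
    klein_effect (hρ x) hσp (hρt x) hσt (hE x) (hE1 x) (h0 x) (fun j hj => by
      have h1 := hdiag j
      rw [show q j = 0 from hj, mul_zero] at h1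
      exact (Finset.sum_eq_zero_iff_of_nonneg fun x _ => hnn x j).1 h1 x (Finset.mem_univ x))
  refine key.trans_eq ?_
  have hl : Real.log 2 ≠ 0 := (Real.log_pos (by norm_num)).ne'
  rw [Finset.sum_sub_distrib, Finset.sum_comm]
  simp only [← Finset.mul_sum, ← hV, ← hq, hdiag, vonNeumannEntropy_eq hσp.1,
    vonNeumannEntropy_eq (hρ _).1, shannonEntropy, ← Finset.sum_div, mul_sub]
  rw [mul_div_cancel₀ _ hl, mul_left_comm, mul_div_cancel₀ _ hl, Finset.sum_neg_distrib,
    Finset.mul_sum]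
  have : ∀ j, Real.log (q j) * (Fintype.card κ * q j)
      = -(Fintype.card κ * Real.negMulLog (q j)) := by
    intro j
    rw [Real.negMulLog]; ring
  simp only [this, Finset.sum_neg_distrib]
  ring

end Spectral

/-! ### Bounds on Shannon entropies -/

lemma shannonEntropy_nonneg {ι : Type*} [Fintype ι] {p : ι → ℝ} (h0 : ∀ i, 0 ≤ p i)
    (h1 : ∀ i, p i ≤ 1) : 0 ≤ shannonEntropy p :=
  div_nonneg (Finset.sum_nonneg fun i _ => Real.negMulLog_nonneg (h0 i) (h1 i))
    (Real.log_nonneg (by norm_num))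

lemma negMulLog_le_one_sub {p : ℝ} (h : 0 ≤ p) : Real.negMulLog p ≤ 1 - p := by
  have := klein_term p 1 h one_pos
  rw [Real.log_one] at this
  rw [Real.negMulLog]
  linarith

lemma shannonEntropy_le_card {ι : Type*} [Fintype ι] {p : ι → ℝ} (h0 : ∀ i, 0 ≤ p i) :
    shannonEntropy p ≤ Fintype.card ι / Real.log 2 := by
  refine div_le_div_of_nonneg_right ?_ (Real.log_nonneg (by norm_num))
  calc ∑ i, Real.negMulLog (p i) ≤ ∑ _i : ι, (1 : ℝ) :=
        Finset.sum_le_sum fun i _ => (negMulLog_le_one_sub (h0 i)).trans (by linarith [h0 i])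
    _ = Fintype.card ι := by simp

lemma le_one_of_mem_stdSimplex {ι : Type*} [Fintype ι] {p : ι → ℝ}
    (hp : p ∈ stdSimplex ℝ ι) (i : ι) : p i ≤ 1 := by
  rw [← hp.2]
  exact Finset.single_le_sum (fun i _ => hp.1 i) (Finset.mem_univ i)

lemma vonNeumannEntropy_nonneg {ι : Type*} [Fintype ι] [DecidableEq ι] {A : Matrix ι ι ℂ}
    (hA : A.PosSemidef) (ht : A.trace = 1) : 0 ≤ vonNeumannEntropy A := by
  rw [vonNeumannEntropy_eq hA.1]
  refine shannonEntropy_nonneg hA.eigenvalues_nonneg fun i => ?_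
  rw [← sum_eigenvalues_eq_one hA.1 ht]
  exact Finset.single_le_sum (fun i _ => hA.eigenvalues_nonneg i) (Finset.mem_univ i)

lemma vonNeumannEntropy_zero {ι : Type*} [Fintype ι] [DecidableEq ι] :
    vonNeumannEntropy (0 : Matrix ι ι ℂ) = 0 := by
  have := vonNeumannEntropy_conj_diagonal (1 : Matrix ι ι ℂ) (by simp) fun _ => 0
  simpa [shannonEntropy] using this

/-! ### The information cost of a protocol -/

namespace QuantumProtocol

variable {n m : ℕ} (P : QuantumProtocol n m)

lemma smul_state_posSemidef {c : ℝ} (hc : 0 ≤ c) (r : Fin P.coins) (x : AliceInput n) :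
    ((c : ℂ) • P.state r x).PosSemidef :=
  (P.state_posSemidef r x).smul (Complex.zero_le_real.2 hc)

/-- The entropy of the global state, by conditioning on its classical registers. -/
lemma vonNeumannEntropy_stateXYPi (μ : AliceInput n × BobInput n m → ℝ) :
    vonNeumannEntropy (P.stateXYPi μ) = ∑ x, ∑ y, ∑ r,
      (Real.negMulLog (μ (x, y) * P.coin r) / Real.log 2
        + μ (x, y) * P.coin r * vonNeumannEntropy (P.state r x)) := by
  unfold stateXYPi
  rw [vonNeumannEntropy_blockDiagonal]
  · rw [Fintype.sum_prod_type]
    refine Finset.sum_congr rfl fun x _ => ?_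
    rw [Fintype.sum_prod_type]
    refine Finset.sum_congr rfl fun y _ => Finset.sum_congr rfl fun r _ => ?_
    exact vonNeumannEntropy_smul (P.state_posSemidef r x).1 (P.state_trace r x) _
  · rintro ⟨x, y, r⟩
    exact (P.state_posSemidef r x).1.smul (Complex.conj_ofReal _)

lemma sum_smul_state_posSemidef {μ : AliceInput n × BobInput n m → ℝ} (hμ : ∀ b, 0 ≤ μ b)
    (y : BobInput n m) (r : Fin P.coins) :
    (∑ x, ((μ (x, y) * P.coin r : ℝ) : ℂ) • P.state r x).PosSemidef :=
  posSemidef_sum _ fun x _ =>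
    P.smul_state_posSemidef (mul_nonneg (hμ _) (P.coin_mem.1 r)) r x

lemma stateYPi_posSemidef {μ : AliceInput n × BobInput n m → ℝ} (hμ : ∀ b, 0 ≤ μ b) :
    (P.stateYPi μ).PosSemidef := by
  refine PosSemidef.of_dotProduct_mulVec_nonneg ?_ fun v => ?_
  · exact isHermitian_blockDiagonal_iff.2 fun b => (P.sum_smul_state_posSemidef hμ b.1 b.2).1
  · have h : star v ⬝ᵥ (P.stateYPi μ *ᵥ v) = ∑ b : BobInput n m × Fin P.coins,
        star (fun w => v (w, b)) ⬝ᵥ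
          ((∑ x, ((μ (x, b.1) * P.coin b.2 : ℝ) : ℂ) • P.state b.2 x) *ᵥ fun w => v (w, b)) := by
      simp only [dotProduct, mulVec, stateYPi]
      rw [Fintype.sum_prod_type_right]
      refine Finset.sum_congr rfl fun b _ => Finset.sum_congr rfl fun w _ => ?_
      rw [Fintype.sum_prod_type_right, Finset.sum_eq_single b]
      · simp [blockDiagonal_apply_eq]
      · intro b' _ hb
        refine Finset.sum_eq_zero fun w' _ => ?_
        rw [blockDiagonal_apply_ne _ _ _ hb.symm, zero_mul]
      · simp
    rw [h]
    exact Finset.sum_nonneg fun b _ =>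
      (P.sum_smul_state_posSemidef hμ b.1 b.2).dotProduct_mulVec_nonneg _

lemma vonNeumannEntropy_stateYPi {μ : AliceInput n × BobInput n m → ℝ} (hμ : ∀ b, 0 ≤ μ b) :
    vonNeumannEntropy (P.stateYPi μ) = ∑ y, ∑ r,
      vonNeumannEntropy (∑ x, ((μ (x, y) * P.coin r : ℝ) : ℂ) • P.state r x) := by
  unfold stateYPi
  rw [vonNeumannEntropy_blockDiagonal, Fintype.sum_prod_type]
  exact fun b => (P.sum_smul_state_posSemidef hμ b.1 b.2).1

lemma sum_prod_coin {μ : AliceInput n × BobInput n m → ℝ} :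
    ∑ x, ∑ y, ∑ r, Real.negMulLog (μ (x, y) * P.coin r)
      = ∑ b, Real.negMulLog (μ b) + (∑ b, μ b) * ∑ r, Real.negMulLog (P.coin r) := by
  simp only [Real.negMulLog_mul, Finset.sum_add_distrib, ← Finset.sum_mul, ← Finset.mul_sum,
    P.coin_mem.2, one_mul, Fintype.sum_prod_type]

lemma shannonEntropy_le_vonNeumannEntropy_stateXYPi {μ : AliceInput n × BobInput n m → ℝ}
    (hμ : μ ∈ stdSimplex ℝ _) : shannonEntropy μ ≤ vonNeumannEntropy (P.stateXYPi μ) := by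
  rw [vonNeumannEntropy_stateXYPi]
  simp only [Finset.sum_add_distrib, ← Finset.sum_div]
  rw [P.sum_prod_coin, hμ.2, one_mul, add_div, add_assoc]
  refine le_add_of_nonneg_right (add_nonneg ?_ ?_)
  · exact shannonEntropy_nonneg P.coin_mem.1 (le_one_of_mem_stdSimplex P.coin_mem)
  · exact Finset.sum_nonneg fun x _ => Finset.sum_nonneg fun y _ => Finset.sum_nonneg fun r _ =>
      mul_nonneg (mul_nonneg (hμ.1 _) (P.coin_mem.1 r))
        (vonNeumannEntropy_nonneg (P.state_posSemidef r x) (P.state_trace r x))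

lemma infoCostAt_le {μ : AliceInput n × BobInput n m → ℝ} (hμ : μ ∈ stdSimplex ℝ _) :
    P.infoCostAt μ ≤ vonNeumannEntropy (P.stateYPi μ) - shannonEntropy fun y => ∑ x, μ (x, y) := by
  have := P.shannonEntropy_le_vonNeumannEntropy_stateXYPi hμ
  unfold infoCostAt
  linarith

lemma bddAbove_infoCostAt :
    BddAbove (P.infoCostAt '' stdSimplex ℝ (AliceInput n × BobInput n m)) := by
  refine ⟨Fintype.card ((Fin P.qubits → Bool) × (BobInput n m × Fin P.coins)) / Real.log 2, ?_⟩
  rintro _ ⟨μ, hμ, rfl⟩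
  have hpos := P.stateYPi_posSemidef hμ.1
  have h1 := shannonEntropy_le_card hpos.eigenvalues_nonneg
  rw [← vonNeumannEntropy_eq] at h1
  have h2 : 0 ≤ shannonEntropy fun y => ∑ x, μ (x, y) := by
    refine shannonEntropy_nonneg (fun y => Finset.sum_nonneg fun x _ => hμ.1 _) fun y => ?_
    rw [← hμ.2, Fintype.sum_prod_type_right]
    exact Finset.single_le_sum (f := fun y => ∑ x, μ (x, y))
      (fun y _ => Finset.sum_nonneg fun x _ => hμ.1 _) (Finset.mem_univ y)
  linarith [P.infoCostAt_le hμ]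

/-- Alice's input is uniform and Bob's input is `y₀`. -/
def uniformAt (n : ℕ) {m : ℕ} (y₀ : BobInput n m) : AliceInput n × BobInput n m → ℝ :=
  fun b => if b.2 = y₀ then (Fintype.card (AliceInput n) : ℝ)⁻¹ else 0

lemma uniformAt_mem (y₀ : BobInput n m) : uniformAt n y₀ ∈ stdSimplex ℝ _ := by
  constructor
  · intro b
    unfold uniformAt
    split_ifs <;> positivity
  · rw [Fintype.sum_prod_type]
    simp [uniformAt]

/-- The mean of Alice's messages for the public randomness `r`. -/
def meanState (r : Fin P.coins) : Matrix (Fin P.qubits → Bool) (Fin P.qubits → Bool) ℂ :=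
  (((Fintype.card (AliceInput n) : ℝ)⁻¹ : ℝ) : ℂ) • ∑ x, P.state r x

lemma meanState_posSemidef (r : Fin P.coins) : (P.meanState r).PosSemidef :=
  (posSemidef_sum _ fun x _ => P.state_posSemidef r x).smul
    (Complex.zero_le_real.2 (by positivity))

lemma meanState_trace (r : Fin P.coins) : (P.meanState r).trace = 1 := by
  simp [meanState, trace_smul, trace_sum, P.state_trace]

/-- At a uniform input of Alice and a fixed input of Bob, the information cost is the Holevo
information of Alice's messages, averaged over the public randomness. -/
lemma infoCostAt_uniformAt (y₀ : BobInput n m) :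
    P.infoCostAt (uniformAt n y₀) = ∑ r, P.coin r * (vonNeumannEntropy (P.meanState r)
      - (Fintype.card (AliceInput n) : ℝ)⁻¹ * ∑ x, vonNeumannEntropy (P.state r x)) := by
  have hY : vonNeumannEntropy (P.stateYPi (uniformAt n y₀)) = ∑ r,
      (Real.negMulLog (P.coin r) / Real.log 2
        + P.coin r * vonNeumannEntropy (P.meanState r)) := by
    rw [P.vonNeumannEntropy_stateYPi (uniformAt_mem y₀).1, Finset.sum_eq_single y₀]
    · refine Finset.sum_congr rfl fun r _ => ?_
      have h : ∑ x, ((uniformAt n y₀ (x, y₀) * P.coin r : ℝ) : ℂ) • P.state r x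
          = ((P.coin r : ℝ) : ℂ) • P.meanState r := by
        simp only [meanState, smul_smul, Finset.smul_sum, uniformAt, if_true, Complex.ofReal_mul,
          mul_comm]
      rw [h, vonNeumannEntropy_smul (P.meanState_posSemidef r).1 (P.meanState_trace r)]
    · intro y _ hy
      refine Finset.sum_eq_zero fun r _ => ?_
      simp [uniformAt, hy, vonNeumannEntropy_zero]
    · simp
  have hH : shannonEntropy (fun y => ∑ x, uniformAt n y₀ (x, y)) = 0 := by
    have h : ∀ y, Real.negMulLog (∑ x, uniformAt n y₀ (x, y)) = 0 := by
      intro y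
      by_cases hy : y = y₀
      · simp [uniformAt, hy]
      · simp [uniformAt, hy]
    simp [shannonEntropy, h]
  have hXY : vonNeumannEntropy (P.stateXYPi (uniformAt n y₀)) = shannonEntropy (uniformAt n y₀)
      + (∑ r, Real.negMulLog (P.coin r)) / Real.log 2
      + ∑ r, P.coin r * ((Fintype.card (AliceInput n) : ℝ)⁻¹
          * ∑ x, vonNeumannEntropy (P.state r x)) := by
    rw [vonNeumannEntropy_stateXYPi]
    simp only [Finset.sum_add_distrib, ← Finset.sum_div]
    rw [P.sum_prod_coin, (uniformAt_mem y₀).2, one_mul, add_div]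
    congr 1
    rw [Finset.sum_congr rfl fun x _ => Finset.sum_comm, Finset.sum_comm]
    refine Finset.sum_congr rfl fun r _ => ?_
    rw [Finset.mul_sum, Finset.mul_sum]
    refine Finset.sum_congr rfl fun x _ => ?_
    rw [Finset.sum_eq_single y₀]
    · simp only [uniformAt, if_true]; ring
    · intro y _ hy
      simp [uniformAt, hy]
    · simp
  unfold infoCostAt
  rw [hY, hH, hXY]
  simp only [mul_sub, Finset.sum_add_distrib, Finset.sum_sub_distrib, ← Finset.sum_div]
  ring

lemma trace_eq_zero_of_wins (hm : m ≤ n) (hP : P.Wins 0) {r : Fin P.coins} (hr : 0 < P.coin r)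
    (x : AliceInput n) (y : BobInput n m) :
    (P.state r x * P.povm r y (restrict x y)).trace.re = 0 := by
  have hnn : ∀ x y r, 0 ≤ P.coin r * (P.state r x * P.povm r y (restrict x y)).trace.re :=
    fun x y r => mul_nonneg (P.coin_mem.1 r)
      (trace_mul_re_nonneg (P.state_posSemidef r x) (P.povm_posSemidef r y _))
  have h1 := eq_zero_of_uniformAverage_le_zero hm P.errorProb
    (fun x y => Finset.sum_nonneg fun r _ => hnn x y r) hP x y
  have h2 := (Finset.sum_eq_zero_iff_of_nonneg fun r _ => hnn x y r).1 h1 r (Finset.mem_univ r)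
  exact (mul_eq_zero.1 h2).resolve_left hr.ne'

lemma one_sub_povm_posSemidef (r : Fin P.coins) (y : BobInput n m) (z : Answer m) :
    (1 - P.povm r y z).PosSemidef := by
  rw [← P.povm_sum r y, ← Finset.sum_erase_eq_sub (Finset.mem_univ z)]
  exact posSemidef_sum _ fun z _ => P.povm_posSemidef r y z

end QuantumProtocol

lemma restrict_surjective {n m : ℕ} (y : BobInput n m) :
    Function.Surjective fun x : AliceInput n => restrict x y := by
  intro z
  refine ⟨Function.extend (y.1.orderEmbOfFin y.2) z fun _ => false, ?_⟩
  funext j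
  exact (y.1.orderEmbOfFin y.2).injective.extend_apply _ _ _

namespace QuantumProtocol

variable {n m : ℕ} (P : QuantumProtocol n m)

/-- An errorless protocol reveals a definite amount of information, whatever its dimension: the
forbidden outcomes have probability zero on the individual messages, but on the mean message the
outcome probabilities add up to one. -/
lemma le_infoCost (hm : m ≤ n) (hP : P.Wins 0) :
    (Real.log 2 * Fintype.card (AliceInput n))⁻¹ ≤ P.infoCost := by
  obtain ⟨y₀⟩ := bobInput_nonempty hm
  refine le_trans ?_ (le_csSup P.bddAbove_infoCostAt ⟨_, uniformAt_mem y₀, rfl⟩)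
  rw [infoCostAt_uniformAt]
  have hl : 0 < Real.log 2 := Real.log_pos (by norm_num)
  have hN : (0 : ℝ) < Fintype.card (AliceInput n) := by exact_mod_cast Fintype.card_pos
  have hr : ∀ r, P.coin r * (Real.log 2 * Fintype.card (AliceInput n))⁻¹ ≤
      P.coin r * (vonNeumannEntropy (P.meanState r)
      - (Fintype.card (AliceInput n) : ℝ)⁻¹ * ∑ x, vonNeumannEntropy (P.state r x)) := by
    intro r
    rcases (P.coin_mem.1 r).eq_or_lt with h0 | h0
    · rw [← h0, zero_mul, zero_mul]
    refine mul_le_mul_of_nonneg_left ?_ h0.le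
    have h1 := sum_effect_le_holevo (P.state r) (fun x => P.povm r y₀ (restrict x y₀))
      (P.state_posSemidef r) (P.state_trace r) (fun x => P.povm_posSemidef r y₀ _)
      (fun x => P.one_sub_povm_posSemidef r y₀ _)
      (fun x => P.trace_eq_zero_of_wins hm hP h0 x y₀) (σ := P.meanState r) (by
        rw [meanState, smul_smul]
        have : (Fintype.card (AliceInput n) : ℂ) * (((Fintype.card (AliceInput n) : ℝ)⁻¹ : ℝ) : ℂ)
            = 1 := by
          push_cast
          exact mul_inv_cancel₀ (by exact_mod_cast hN.ne')
        rw [this, one_smul])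
    have h2 : 1 ≤ ∑ x, (P.meanState r * P.povm r y₀ (restrict x y₀)).trace.re := by
      have hsum : ∑ z, (P.meanState r * P.povm r y₀ z).trace.re = 1 := by
        rw [← Complex.re_sum, ← trace_sum, ← Finset.mul_sum, P.povm_sum, mul_one,
          P.meanState_trace, Complex.one_re]
      rw [← hsum]
      set g := Function.surjInv (restrict_surjective y₀) with hg
      have hgr : ∀ z, restrict (g z) y₀ = z := Function.surjInv_eq (restrict_surjective y₀)
      calc ∑ z, (P.meanState r * P.povm r y₀ z).trace.re
          = ∑ z, (P.meanState r * P.povm r y₀ (restrict (g z) y₀)).trace.re := by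
            simp only [hgr]
        _ = ∑ x ∈ Finset.univ.image g,
              (P.meanState r * P.povm r y₀ (restrict x y₀)).trace.re := by
            rw [Finset.sum_image fun a _ b _ hab => Function.injective_surjInv _ hab]
        _ ≤ _ := Finset.sum_le_sum_of_subset_of_nonneg (Finset.subset_univ _) fun x _ _ =>
            trace_mul_re_nonneg (P.meanState_posSemidef r) (P.povm_posSemidef r y₀ _)
    have h3 := h2.trans h1
    rw [inv_le_iff_one_le_mul₀ (by positivity)]
    refine h3.trans_eq ?_
    field_simp
  calc (Real.log 2 * Fintype.card (AliceInput n))⁻¹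
      = ∑ r, P.coin r * (Real.log 2 * Fintype.card (AliceInput n))⁻¹ := by
        rw [← Finset.sum_mul, P.coin_mem.2, one_mul]
    _ ≤ _ := Finset.sum_le_sum fun r _ => hr r

end QuantumProtocol

/-! ### The exclusion measurement of Pusey, Barrett and Rudolph -/

/-- The entry `(-1) ^ (s t)` of the Hadamard matrix. -/
def sign (s t : Bool) : ℝ := if s && t then -1 else 1

lemma sign_mul_self (s t : Bool) : sign s t * sign s t = 1 := by
  cases s <;> cases t <;> simp [sign]

/-- The amplitude at `w` of the product of the qubits `a |0⟩ + (-1) ^ (x i) b |1⟩`. -/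
def amplitude {n : ℕ} (a b : ℝ) (x w : AliceInput n) : ℝ :=
  ∏ i, sign (x i) (w i) * if w i then b else a

/-- The character `w ↦ (-1) ^ ⟨z, w⟩` of the restriction of `w` to `y`. -/
def character {n m : ℕ} (y : BobInput n m) (z : Answer m) (w : AliceInput n) : ℝ :=
  ∏ j, sign (z j) (w (y.1.orderEmbOfFin y.2 j))

/-- The sign that is `-1` exactly at the strings vanishing on `y`. -/
def phase {n m : ℕ} (y : BobInput n m) (w : AliceInput n) : ℝ :=
  if ∀ i ∈ y.1, w i = false then -1 else 1

lemma sum_prod_eq_prod_sum {n : ℕ} (f : Fin n → Bool → ℝ) :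
    ∑ w : AliceInput n, ∏ i, f i (w i) = ∏ i, ∑ t, f i t := by
  rw [Finset.prod_univ_sum, Fintype.piFinset_univ]

lemma sum_character_mul {n m : ℕ} (y : BobInput n m) (w w' : AliceInput n) :
    ∑ z, character y z w * character y z w' = if ∀ i ∈ y.1, w i = w' i then 2 ^ m else 0 := by
  have h1 : ∑ z, character y z w * character y z w' = ∏ j : Fin m, ∑ t,
      sign t (w (y.1.orderEmbOfFin y.2 j)) * sign t (w' (y.1.orderEmbOfFin y.2 j)) := by
    rw [← sum_prod_eq_prod_sum (fun j t =>
      sign t (w (y.1.orderEmbOfFin y.2 j)) * sign t (w' (y.1.orderEmbOfFin y.2 j)))]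
    simp only [character, Finset.prod_mul_distrib]
  have h2 : ∀ s t : Bool, ∑ r, sign r s * sign r t = if s = t then 2 else 0 := by
    intro s t
    cases s <;> cases t <;> norm_num [sign]
  rw [h1]
  simp only [h2]
  split_ifs with h
  · simp [h _ (Finset.orderEmbOfFin_mem y.1 y.2 _)]
  · push Not at h
    obtain ⟨i, hi, hne⟩ := h
    rw [← Finset.mem_coe, ← Finset.range_orderEmbOfFin y.1 y.2] at hi
    obtain ⟨j, rfl⟩ := hi
    exact Finset.prod_eq_zero (Finset.mem_univ j) (if_neg hne)

lemma character_restrict {n m : ℕ} (y : BobInput n m) (x w : AliceInput n) :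
    character y (restrict x y) w = ∏ i, if i ∈ y.1 then sign (x i) (w i) else 1 := by
  rw [Finset.prod_ite_mem, Finset.univ_inter]
  refine Finset.prod_bij (fun j _ => y.1.orderEmbOfFin y.2 j)
    (fun j _ => Finset.orderEmbOfFin_mem y.1 y.2 j)
    (fun j _ k _ h => (y.1.orderEmbOfFin y.2).injective h) (fun i hi => ?_) fun j _ => rfl
  rw [← Finset.mem_coe, ← Finset.range_orderEmbOfFin y.1 y.2] at hi
  obtain ⟨j, rfl⟩ := hi
  exact ⟨j, Finset.mem_univ j, rfl⟩

lemma phase_eq {n m : ℕ} (y : BobInput n m) (w : AliceInput n) :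
    phase y w = 1 - 2 * ∏ i, if i ∈ y.1 then (if w i then 0 else 1) else 1 := by
  rw [Finset.prod_ite_mem, Finset.univ_inter]
  unfold phase
  split_ifs with h
  · rw [Finset.prod_eq_one fun i hi => by simp [h i hi]]
    norm_num
  · push Not at h
    obtain ⟨i, hi, hne⟩ := h
    rw [Finset.prod_eq_zero hi (by simpa using hne)]
    norm_num

/-- The state of Alice's input `x` is orthogonal to the outcome `z = restrict x y`. On the qubits
in `y` the overlap is proportional to `(a + b) ^ m - 2 a ^ m`, the sum of all `2 ^ m` amplitudes
with the sign of the first one reversed. -/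
lemma sum_amplitude_mul_character {n m : ℕ} {a b : ℝ} (hab : (a + b) ^ m = 2 * a ^ m)
    (x : AliceInput n) (y : BobInput n m) (u : {i // i ∉ y.1} → Bool) :
    ∑ w : AliceInput n, amplitude a b x w * (if (fun i : {i // i ∉ y.1} => w i) = u then
      phase y w * character y (restrict x y) w else 0) = 0 := by
  let f : Fin n → Bool → ℝ := fun i t => if hi : i ∈ y.1 then (if t then b else a) else
    if t = u ⟨i, hi⟩ then sign (x i) t * (if t then b else a) else 0
  let g : Fin n → Bool → ℝ := fun i t => (if i ∈ y.1 then (if t then 0 else 1) else 1) * f i t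
  have hterm : ∀ w : AliceInput n, amplitude a b x w *
      (if (fun i : {i // i ∉ y.1} => w i) = u then
        phase y w * character y (restrict x y) w else 0)
      = ∏ i, f i (w i) - 2 * ∏ i, g i (w i) := by
    intro w
    have hg : ∏ i, g i (w i)
        = (∏ i, if i ∈ y.1 then (if w i then 0 else 1) else 1) * ∏ i, f i (w i) :=
      Finset.prod_mul_distrib
    have hphase : ∏ i, f i (w i) - 2 * ∏ i, g i (w i) = phase y w * ∏ i, f i (w i) := by
      rw [hg, phase_eq]; ring
    rw [hphase]
    by_cases hu : (fun i : {i // i ∉ y.1} => w i) = u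
    · have : ∏ i, f i (w i) = amplitude a b x w * character y (restrict x y) w := by
        rw [character_restrict, amplitude, ← Finset.prod_mul_distrib]
        refine Finset.prod_congr rfl fun i _ => ?_
        by_cases hi : i ∈ y.1
        · simp only [f, hi, dif_pos, if_true]
          rw [mul_right_comm, sign_mul_self, one_mul]
        · have : w i = u ⟨i, hi⟩ := congrFun hu ⟨i, hi⟩
          simp only [f, hi, dif_neg, not_false_eq_true, if_neg, this, if_true, mul_one]
      rw [if_pos hu, this]; ring
    · have : ∏ i, f i (w i) = 0 := by
        by_contra hne
        refine hu (funext fun i => ?_)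
        by_contra hi
        refine hne (Finset.prod_eq_zero (Finset.mem_univ i.1) ?_)
        simp only [f, i.2, dif_neg, not_false_eq_true, Subtype.coe_eta, if_neg hi]
      rw [if_neg hu, this, mul_zero, mul_zero]
  have hsplit : ∀ h : Fin n → ℝ, ∏ i, h i = (∏ i ∈ y.1, h i) * ∏ i ∈ y.1ᶜ, h i :=
    fun h => (Finset.prod_mul_prod_compl _ _).symm
  have hR : ∏ i ∈ y.1ᶜ, ∑ t, g i t = ∏ i ∈ y.1ᶜ, ∑ t, f i t := by
    refine Finset.prod_congr rfl fun i hi => ?_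
    simp [g, Finset.mem_compl.1 hi]
  have hF : ∏ i ∈ y.1, ∑ t, f i t = (a + b) ^ m := by
    rw [Finset.prod_congr rfl (g := fun _ => a + b), Finset.prod_const, y.2]
    intro i hi
    simp [f, hi, add_comm]
  have hG : ∏ i ∈ y.1, ∑ t, g i t = a ^ m := by
    rw [Finset.prod_congr rfl (g := fun _ => a), Finset.prod_const, y.2]
    intro i hi
    simp [g, f, hi]
  rw [Finset.sum_congr rfl fun w _ => hterm w, Finset.sum_sub_distrib, ← Finset.mul_sum,
    sum_prod_eq_prod_sum, sum_prod_eq_prod_sum, hsplit, hsplit fun i => ∑ t, g i t, hR, hF, hG,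
    hab]
  ring

/-- The isometry (up to a factor) whose range is the range of the effect for the outcome `z`. -/
def exclusionFactor {n m : ℕ} (y : BobInput n m) (z : Answer m) :
    Matrix (Fin n → Bool) ({i // i ∉ y.1} → Bool) ℂ :=
  Matrix.of fun w u => ((if (fun i : {i // i ∉ y.1} => w i) = u then
    phase y w * character y z w else 0 : ℝ) : ℂ)

/-- The effect for the outcome `z`: the projection onto the vector
`2 ^ (-m / 2) ∑ v, ± (-1) ^ ⟨z, v⟩ |v⟩` of the qubits in `y`, where the sign is `-1` at `v = 0`
only, tensored with the identity on the other qubits. -/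
def exclusionEffect {n m : ℕ} (y : BobInput n m) (z : Answer m) :
    Matrix (Fin n → Bool) (Fin n → Bool) ℂ :=
  (((2 : ℝ) ^ m)⁻¹ : ℝ) • (exclusionFactor y z * (exclusionFactor y z)ᴴ)

lemma exclusionEffect_posSemidef {n m : ℕ} (y : BobInput n m) (z : Answer m) :
    (exclusionEffect y z).PosSemidef :=
  (posSemidef_self_mul_conjTranspose _).smul (by positivity)

lemma phase_mul_self {n m : ℕ} (y : BobInput n m) (w : AliceInput n) :
    phase y w * phase y w = 1 := by
  unfold phase
  split_ifs <;> norm_num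

lemma exclusionFactor_mul_apply {n m : ℕ} (y : BobInput n m) (z : Answer m) (w w' : Fin n → Bool) :
    (exclusionFactor y z * (exclusionFactor y z)ᴴ) w w' =
      ((if ∀ i ∉ y.1, w i = w' i then phase y w * phase y w' *
        (character y z w * character y z w') else 0 : ℝ) : ℂ) := by
  rw [Matrix.mul_apply]
  simp only [exclusionFactor, conjTranspose_apply, Matrix.of_apply, RCLike.star_def,
    Complex.conj_ofReal, ← Complex.ofReal_mul, ← Complex.ofReal_sum]
  congr 1
  simp only [ite_mul, zero_mul, Finset.sum_ite_eq, Finset.mem_univ, if_true]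
  have : ((fun i : {i // i ∉ y.1} => w' i) = fun i : {i // i ∉ y.1} => w i)
      ↔ ∀ i ∉ y.1, w i = w' i := by
    rw [funext_iff, Subtype.forall]
    exact forall₂_congr fun i _ => eq_comm
  simp only [this]
  split_ifs <;> ring

lemma sum_exclusionEffect {n m : ℕ} (y : BobInput n m) :
    ∑ z : Answer m, exclusionEffect y z = 1 := by
  ext w w'
  simp only [Matrix.sum_apply, exclusionEffect, Matrix.smul_apply, exclusionFactor_mul_apply,
    Complex.real_smul, ← Complex.ofReal_mul, ← Complex.ofReal_sum, ← Finset.mul_sum]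
  rw [one_apply]
  by_cases hoff : ∀ i ∉ y.1, w i = w' i
  · simp only [if_pos hoff, ← Finset.mul_sum, sum_character_mul]
    by_cases hon : ∀ i ∈ y.1, w i = w' i
    · have hw : w = w' := funext fun i => by
        by_cases hi : i ∈ y.1
        · exact hon i hi
        · exact hoff i hi
      subst hw
      rw [if_pos hon, if_pos rfl, phase_mul_self, one_mul, inv_mul_cancel₀ (by positivity)]
      simp
    · rw [if_neg hon, if_neg fun h => hon fun i _ => congrFun h i]
      simp
  · rw [if_neg fun h => hoff fun i _ => congrFun h i]
    simp [hoff]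

lemma sum_amplitude_sq {n : ℕ} {a b : ℝ} (h1 : a ^ 2 + b ^ 2 = 1) (x : AliceInput n) :
    ∑ w, amplitude a b x w * amplitude a b x w = 1 := by
  simp only [amplitude, ← Finset.prod_mul_distrib]
  rw [sum_prod_eq_prod_sum fun i t => (sign (x i) t * if t then b else a)
    * (sign (x i) t * if t then b else a)]
  refine Finset.prod_eq_one fun i _ => ?_
  rw [Fintype.sum_bool, mul_mul_mul_comm, sign_mul_self, mul_mul_mul_comm, sign_mul_self]
  simp
  linarith

lemma amplitude_sq {n : ℕ} (a b : ℝ) (x w : AliceInput n) :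
    amplitude a b x w * amplitude a b x w = ∏ i, if w i then b ^ 2 else a ^ 2 := by
  simp only [amplitude, ← Finset.prod_mul_distrib]
  refine Finset.prod_congr rfl fun i _ => ?_
  rw [mul_mul_mul_comm, sign_mul_self]
  split_ifs <;> ring

/-- The protocol in which Alice encodes each bit in a qubit `a |0⟩ ± b |1⟩` and Bob applies the
exclusion measurement to the qubits in his set. -/
def exclusionProtocol (n m : ℕ) {a b : ℝ} (h1 : a ^ 2 + b ^ 2 = 1) : QuantumProtocol n m where
  coins := 1
  coin := fun _ => 1
  coin_mem := ⟨fun _ => zero_le_one, by simp⟩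
  qubits := n
  state := fun _ x => vecMulVec (fun w => (amplitude a b x w : ℂ))
    (star fun w => (amplitude a b x w : ℂ))
  state_posSemidef := fun _ _ => posSemidef_vecMulVec_self_star _
  state_trace := fun _ x => by
    have := congrArg (fun r : ℝ => (r : ℂ)) (sum_amplitude_sq h1 x)
    simpa [Matrix.trace, vecMulVec_apply] using this
  povm := fun _ y z => exclusionEffect y z
  povm_posSemidef := fun _ y z => exclusionEffect_posSemidef y z
  povm_sum := fun _ y => sum_exclusionEffect y

lemma state_mul_exclusionEffect {n m : ℕ} {a b : ℝ} (hab : (a + b) ^ m = 2 * a ^ m)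
    (x : AliceInput n) (y : BobInput n m) :
    vecMulVec (fun w => (amplitude a b x w : ℂ)) (star fun w => (amplitude a b x w : ℂ))
      * exclusionEffect y (restrict x y) = 0 := by
  have hv : (star fun w => (amplitude a b x w : ℂ)) ᵥ* exclusionFactor y (restrict x y) = 0 := by
    funext u
    have := congrArg (fun r : ℝ => (r : ℂ)) (sum_amplitude_mul_character hab x y u)
    simp only [Complex.ofReal_sum, Complex.ofReal_mul, Complex.ofReal_zero] at this
    simp only [vecMul, dotProduct, exclusionFactor, Matrix.of_apply, Pi.star_apply,
      RCLike.star_def, Complex.conj_ofReal, Pi.zero_apply]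
    exact this
  rw [exclusionEffect, Matrix.mul_smul, vecMulVec_mul, ← vecMul_vecMul, hv, zero_vecMul]
  ext
  simp

lemma exclusionProtocol_wins {n m : ℕ} {a b : ℝ} (h1 : a ^ 2 + b ^ 2 = 1)
    (hab : (a + b) ^ m = 2 * a ^ m) : (exclusionProtocol n m h1).Wins 0 := by
  refine (uniformAverage_zero fun x y => ?_).le
  refine Finset.sum_eq_zero fun r _ => ?_
  have : (exclusionProtocol n m h1).state r x * (exclusionProtocol n m h1).povm r y (restrict x y)
      = 0 := state_mul_exclusionEffect hab x y
  simp [this]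

/-- The entropy of `n` independent copies. -/
lemma sum_negMulLog_prod (n : ℕ) {q : Bool → ℝ} (hq : ∑ t, q t = 1) :
    ∑ w : AliceInput n, Real.negMulLog (∏ i, q (w i)) = n * ∑ t, Real.negMulLog (q t) := by
  induction n with
  | zero => simp
  | succ n ih =>
    rw [← (Fin.consEquiv fun _ => Bool).sum_comp, Fintype.sum_prod_type]
    have h1 : ∑ w : AliceInput n, ∏ i, q (w i) = 1 := by
      rw [sum_prod_eq_prod_sum fun _ t => q t]
      exact Finset.prod_eq_one fun _ _ => hq
    simp only [Fin.consEquiv_apply, Fin.prod_univ_succ, Fin.cons_zero, Fin.cons_succ,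
      Real.negMulLog_mul, Finset.sum_add_distrib, ← Finset.sum_mul, ← Finset.mul_sum, ih, h1, hq]
    push_cast
    ring

lemma QuantumProtocol.stateYPi_apply_self_re {n m : ℕ} (P : QuantumProtocol n m)
    (μ : AliceInput n × BobInput n m → ℝ) (w : Fin P.qubits → Bool) (y : BobInput n m)
    (r : Fin P.coins) : (P.stateYPi μ (w, (y, r)) (w, (y, r))).re
      = ∑ x, μ (x, y) * P.coin r * (P.state r x w w).re := by
  rw [stateYPi, blockDiagonal_apply_eq, Matrix.sum_apply, Complex.re_sum]
  refine Finset.sum_congr rfl fun x _ => ?_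
  rw [Matrix.smul_apply, smul_eq_mul, Complex.re_ofReal_mul]

/-- All the states sent have the same product distribution on the diagonal, so that the message
carries at most the entropy of that distribution. -/
lemma infoCost_exclusionProtocol_le {n m : ℕ} {a b : ℝ} (h1 : a ^ 2 + b ^ 2 = 1) :
    (exclusionProtocol n m h1).infoCost
      ≤ n * (Real.negMulLog (b ^ 2) + Real.negMulLog (a ^ 2)) / Real.log 2 := by
  set P := exclusionProtocol n m h1 with hP
  have hB : 0 ≤ Real.negMulLog (b ^ 2) + Real.negMulLog (a ^ 2) :=
    add_nonneg (Real.negMulLog_nonneg (sq_nonneg _) (by nlinarith [sq_nonneg a]))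
      (Real.negMulLog_nonneg (sq_nonneg _) (by nlinarith [sq_nonneg b]))
  refine Real.sSup_le ?_ (div_nonneg (mul_nonneg (Nat.cast_nonneg _) hB)
    (Real.log_nonneg (by norm_num)))
  rintro _ ⟨μ, hμ, rfl⟩
  refine (P.infoCostAt_le hμ).trans ?_
  have hd := vonNeumannEntropy_le_diag (P.stateYPi_posSemidef hμ.1)
  let q : Bool → ℝ := fun t => if t then b ^ 2 else a ^ 2
  have hq : ∑ t, q t = 1 := by simp [q]; linarith
  have hq1 : ∑ w : AliceInput n, ∏ i, q (w i) = 1 := by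
    rw [sum_prod_eq_prod_sum fun _ t => q t]
    exact Finset.prod_eq_one fun _ _ => hq
  have hμ1 : ∑ y, ∑ x, μ (x, y) = 1 := by rw [← Fintype.sum_prod_type_right]; exact hμ.2
  have hdiag : ∀ (w : AliceInput n) (y : BobInput n m) (r : Fin 1),
      (P.stateYPi μ (w, (y, r)) (w, (y, r))).re = (∑ x, μ (x, y)) * ∏ i, q (w i) := by
    intro w y r
    refine (P.stateYPi_apply_self_re μ w y r).trans ?_
    rw [Finset.sum_mul]
    refine Finset.sum_congr rfl fun x _ => ?_
    have h2 : (P.state r x w w).re = ∏ i, q (w i) := by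
      have h3 : P.state r x w w = (amplitude a b x w : ℂ) * star (amplitude a b x w : ℂ) := rfl
      rw [h3, RCLike.star_def, Complex.conj_ofReal, ← Complex.ofReal_mul, Complex.ofReal_re,
        amplitude_sq]
    have h3 : P.coin r = 1 := rfl
    rw [h2, h3, mul_one]
  have hS : shannonEntropy (fun i => (P.stateYPi μ i i).re)
      = (n * (Real.negMulLog (b ^ 2) + Real.negMulLog (a ^ 2))
        + ∑ y, Real.negMulLog (∑ x, μ (x, y))) / Real.log 2 := by
    unfold shannonEntropy
    congr 1
    have : ∑ i, Real.negMulLog (P.stateYPi μ i i).re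
        = ∑ w : AliceInput n, ∑ y : BobInput n m, ∑ r : Fin 1,
          Real.negMulLog (P.stateYPi μ (w, (y, r)) (w, (y, r))).re := by
      rw [Fintype.sum_prod_type]
      refine Finset.sum_congr rfl fun w _ => ?_
      rw [Fintype.sum_prod_type]
      rfl
    rw [this]
    simp only [hdiag, Finset.univ_unique, Finset.sum_singleton, Real.negMulLog_mul,
      Finset.sum_add_distrib, ← Finset.sum_mul, ← Finset.mul_sum, hq1, hμ1,
      sum_negMulLog_prod n hq, one_mul]
    simp [q]
    ring
  rw [hS, add_div] at hd
  have : shannonEntropy (fun y => ∑ x, μ (x, y))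
      = (∑ y, Real.negMulLog (∑ x, μ (x, y))) / Real.log 2 := rfl
  linarith

/-! ### The angle between the qubits -/

/-- The ratio `b / a = 2 ^ (1 / m) - 1` lies between `1 / (2 m)` and `1 / m`. -/
lemma exists_angle {m : ℕ} (hm : 1 ≤ m) : ∃ a b : ℝ, a ^ 2 + b ^ 2 = 1 ∧
    (a + b) ^ m = 2 * a ^ m ∧ b ^ 2 ≤ 1 / (m : ℝ) ^ 2 ∧ 1 / (8 * (m : ℝ) ^ 2) ≤ b ^ 2 := by
  have hm0 : (0 : ℝ) < m := by exact_mod_cast hm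
  have hm1 : (1 : ℝ) ≤ m := by exact_mod_cast hm
  set s : ℝ := (2 : ℝ) ^ ((1 : ℝ) / m) with hs
  have hs0 : 0 < s := Real.rpow_pos_of_pos (by norm_num) _
  have hsm : s ^ m = 2 := by
    rw [hs, ← Real.rpow_natCast, ← Real.rpow_mul (by norm_num), one_div_mul_cancel hm0.ne',
      Real.rpow_one]
  have hup : s ≤ 1 + 1 / m := by
    refine le_of_pow_le_pow_left₀ (by omega : m ≠ 0) (by positivity) ?_
    rw [hsm]
    have := one_add_mul_le_pow (a := (1 : ℝ) / m) (by
      have : 0 ≤ (1 : ℝ) / m := by positivity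
      linarith) m
    rw [mul_one_div_cancel hm0.ne'] at this
    linarith
  have hlow : 1 + 1 / (2 * m) ≤ s := by
    have h1 : s = Real.exp (Real.log 2 * (1 / m)) := by
      rw [hs, Real.rpow_def_of_pos (by norm_num)]
    have h2 := Real.add_one_le_exp (Real.log 2 * (1 / m))
    have h3 : (1 : ℝ) / 2 ≤ Real.log 2 := by linarith [Real.log_two_gt_d9]
    have h4 : 1 / (2 * (m : ℝ)) ≤ Real.log 2 * (1 / m) := by
      have : 1 / (2 * (m : ℝ)) = 1 / 2 * (1 / m) := by field_simp
      rw [this]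
      gcongr
    linarith
  set t := s - 1 with ht
  have ht0 : 0 ≤ t := by
    have : 0 ≤ 1 / (2 * (m : ℝ)) := by positivity
    linarith
  have ht1 : t ≤ 1 := by
    have : (1 : ℝ) / m ≤ 1 := (div_le_one hm0).2 hm1
    linarith
  have hr : 0 < 1 + t ^ 2 := by positivity
  have hsq := Real.sq_sqrt hr.le
  have hr0 : 0 < √(1 + t ^ 2) := Real.sqrt_pos.2 hr
  have hb : (t / √(1 + t ^ 2)) ^ 2 = t ^ 2 / (1 + t ^ 2) := by rw [div_pow, hsq]
  refine ⟨1 / √(1 + t ^ 2), t / √(1 + t ^ 2), ?_, ?_, ?_, ?_⟩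
  · rw [hb, div_pow, hsq, one_pow, ← add_div, div_self hr.ne']
  · rw [← add_div, div_pow, ht, add_sub_cancel, hsm, one_div, inv_pow, div_eq_mul_inv]
  · rw [hb]
    calc t ^ 2 / (1 + t ^ 2) ≤ t ^ 2 := div_le_self (sq_nonneg _) (by nlinarith [sq_nonneg t])
      _ ≤ (1 / m) ^ 2 := pow_le_pow_left₀ ht0 (by linarith) 2
      _ = 1 / (m : ℝ) ^ 2 := by rw [div_pow, one_pow]
  · rw [hb]
    calc 1 / (8 * (m : ℝ) ^ 2) = (1 / (2 * m)) ^ 2 / 2 := by field_simp; norm_num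
      _ ≤ t ^ 2 / 2 := by gcongr; linarith
      _ ≤ t ^ 2 / (1 + t ^ 2) := by gcongr; nlinarith

/-! ### Quantum information complexity -/

lemma quantumIC_pos {n m : ℕ} (hm : 1 ≤ m) (hmn : m ≤ n) : 0 < quantumIC n m 0 := by
  obtain ⟨a, b, h1, hab, -⟩ := exists_angle hm
  have hl : 0 < Real.log 2 := Real.log_pos (by norm_num)
  have hN : (0 : ℝ) < Fintype.card (AliceInput n) := by exact_mod_cast Fintype.card_pos
  refine lt_of_lt_of_le (inv_pos.2 (mul_pos hl hN)) (le_csInf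
    ⟨_, exclusionProtocol n m h1, exclusionProtocol_wins h1 hab, rfl⟩ ?_)
  rintro _ ⟨P, hP, rfl⟩
  exact P.le_infoCost hmn hP

lemma quantumIC_le {n m : ℕ} (hm : 2 ≤ m) (hmn : m ≤ n) :
    quantumIC n m 0 ≤ 14 * (n * ((m : ℝ) ^ 2)⁻¹ * Real.log m) := by
  obtain ⟨a, b, h1, hab, hup, hlow⟩ := exists_angle (by omega : 1 ≤ m)
  have hl : 1 / 2 ≤ Real.log 2 := by linarith [Real.log_two_gt_d9]
  have hm2 : (2 : ℝ) ≤ m := by exact_mod_cast hm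
  have hlm : Real.log 2 ≤ Real.log m := Real.log_le_log (by norm_num) hm2
  have h2 : quantumIC n m 0
      ≤ n * (Real.negMulLog (b ^ 2) + Real.negMulLog (a ^ 2)) / Real.log 2 := by
    refine le_trans (csInf_le ⟨0, ?_⟩
      ⟨exclusionProtocol n m h1, exclusionProtocol_wins h1 hab, rfl⟩)
      (infoCost_exclusionProtocol_le h1)
    rintro _ ⟨P, hP, rfl⟩
    exact le_trans (by positivity) (P.le_infoCost hmn hP)
  have hb : Real.negMulLog (b ^ 2) ≤ ((m : ℝ) ^ 2)⁻¹ * (5 * Real.log m) := by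
    have hpos : 0 < 1 / (8 * (m : ℝ) ^ 2) := by positivity
    have h3 : -Real.log (b ^ 2) ≤ 5 * Real.log m := by
      have h4 := Real.log_le_log hpos hlow
      rw [one_div, Real.log_inv, Real.log_mul (by norm_num) (by positivity), Real.log_pow,
        show (8 : ℝ) = 2 ^ 3 by norm_num, Real.log_pow] at h4
      push_cast at h4
      linarith
    rw [Real.negMulLog, neg_mul, ← mul_neg]
    rw [one_div] at hup
    exact mul_le_mul hup h3 (neg_nonneg.2 (Real.log_nonpos (sq_nonneg _)
      (by nlinarith [sq_nonneg a]))) (by positivity)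
  have ha : Real.negMulLog (a ^ 2) ≤ ((m : ℝ) ^ 2)⁻¹ * (2 * Real.log m) := by
    have h3 := negMulLog_le_one_sub (sq_nonneg a)
    rw [one_div] at hup
    have h4 : ((m : ℝ) ^ 2)⁻¹ * 1 ≤ ((m : ℝ) ^ 2)⁻¹ * (2 * Real.log m) :=
      mul_le_mul_of_nonneg_left (by linarith) (by positivity)
    linarith
  refine h2.trans ?_
  rw [div_le_iff₀ (by linarith)]
  have hX : 0 ≤ n * ((m : ℝ) ^ 2)⁻¹ * Real.log m :=
    mul_nonneg (by positivity) (by linarith)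
  calc n * (Real.negMulLog (b ^ 2) + Real.negMulLog (a ^ 2))
      ≤ n * (((m : ℝ) ^ 2)⁻¹ * (5 * Real.log m) + ((m : ℝ) ^ 2)⁻¹ * (2 * Real.log m)) := by gcongr
    _ = 14 * (n * ((m : ℝ) ^ 2)⁻¹ * Real.log m) * (1 / 2) := by ring
    _ ≤ _ := by gcongr

/-! ### Quantum communication -/

section Effects

variable {ι : Type*} [Fintype ι] [DecidableEq ι]

lemma trace_re_eq_sum_eigenvalues {A : Matrix ι ι ℂ} (hA : A.IsHermitian) :
    A.trace.re = ∑ k, hA.eigenvalues k := by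
  rw [hA.trace_eq_sum_eigenvalues, Complex.re_sum]
  rfl

lemma norm_apply_le_trace {A : Matrix ι ι ℂ} (hA : A.PosSemidef) (i j : ι) :
    ‖A i j‖ ≤ A.trace.re := by
  have hU : ∀ i k, ‖(hA.1.eigenvectorUnitary : Matrix ι ι ℂ) i k‖ ≤ 1 := by
    intro i k
    have h1 := sum_normSq_row (eigenvectorUnitary_mul_conjTranspose hA.1) i
    have h2 := Finset.single_le_sum (f := fun k =>
      Complex.normSq ((hA.1.eigenvectorUnitary : Matrix ι ι ℂ) i k))
      (fun k _ => Complex.normSq_nonneg _) (Finset.mem_univ k)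
    rw [h1, Complex.normSq_eq_norm_sq] at h2
    exact (sq_le_one_iff₀ (norm_nonneg _)).1 h2
  rw [trace_re_eq_sum_eigenvalues hA.1]
  conv_lhs => rw [spectral_eq hA.1]
  rw [Matrix.mul_apply]
  refine (norm_sum_le _ _).trans (Finset.sum_le_sum fun k _ => ?_)
  have h0 := hA.eigenvalues_nonneg k
  rw [Matrix.mul_diagonal, conjTranspose_apply, norm_mul, norm_mul, norm_star, Complex.norm_real,
    Real.norm_of_nonneg h0]
  calc _ ≤ 1 * hA.1.eigenvalues k * 1 := by
        gcongr
        · exact hU i k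
        · exact hU j k
    _ = _ := by ring

/-- By Carathéodory's theorem a measurement in dimension `d` can be thinned out to `2 d ^ 2 + 1`
outcomes, each of whose effects is a multiple of an original one. Hence, whatever the number of
outcomes, some rescaled effect has probability at least `1 / (2 d ^ 2 + 1)` on a given state. -/
lemma exists_effect_trace_ge {κ : Type*} [Fintype κ] [Nonempty κ] (E : κ → Matrix ι ι ℂ)
    (hE : ∀ z, (E z).PosSemidef) (hsum : ∑ z, E z = 1) {ρ : Matrix ι ι ℂ} (hρt : ρ.trace = 1) :
    ∃ (z : κ) (c : ℝ), (c • E z).PosSemidef ∧ (c • E z).trace.re ≤ Fintype.card ι ∧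
      (2 * (Fintype.card ι : ℝ) ^ 2 + 1)⁻¹ ≤ (ρ * c • E z).trace.re := by
  have hN : (0 : ℝ) < Fintype.card κ := by exact_mod_cast Fintype.card_pos
  have hmem : (Fintype.card κ : ℝ)⁻¹ • (1 : Matrix ι ι ℂ) ∈ convexHull ℝ (Set.range E) := by
    rw [← hsum, Finset.smul_sum]
    refine (convex_convexHull ℝ _).sum_mem (fun _ _ => by positivity) ?_
      fun z _ => subset_convexHull ℝ _ ⟨z, rfl⟩
    simp [hN.ne']
  obtain ⟨τ, hτ, A, w, hA, haff, hw, hw1, hw2⟩ := eq_pos_convex_span_of_mem_convexHull hmem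
  choose g hg using fun t => hA ⟨t, rfl⟩
  set F : τ → Matrix ι ι ℂ := fun t => (Fintype.card κ * w t) • E (g t) with hF
  have hFsum : ∑ t, F t = 1 := by
    simp only [hF, hg, mul_smul, ← Finset.smul_sum, hw2]
    rw [smul_smul, mul_inv_cancel₀ hN.ne', one_smul]
  have hFpos : ∀ t, (F t).PosSemidef := fun t => (hE _).smul (mul_nonneg hN.le (hw t).le)
  have hcard : (Fintype.card τ : ℝ) ≤ 2 * (Fintype.card ι : ℝ) ^ 2 + 1 := by
    have h1 := haff.card_le_finrank_succ
    have h2 := Submodule.finrank_le (vectorSpan ℝ (Set.range A))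
    rw [Module.finrank_matrix, Complex.finrank_real_complex] at h2
    have h3 : Fintype.card τ ≤ 2 * Fintype.card ι ^ 2 + 1 := by
      refine h1.trans ?_
      rw [sq]
      omega
    exact_mod_cast h3
  have hτ0 : Nonempty τ := by
    by_contra h
    rw [not_nonempty_iff] at h
    simp at hw1
  have hτ1 : (0 : ℝ) < Fintype.card τ := by exact_mod_cast Fintype.card_pos
  obtain ⟨t, -, ht⟩ := Finset.exists_le_of_sum_le (s := (Finset.univ : Finset τ))
    (f := fun _ => (Fintype.card τ : ℝ)⁻¹) (g := fun t => (ρ * F t).trace.re)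
    Finset.univ_nonempty (by
      rw [← Complex.re_sum, ← trace_sum, ← Finset.mul_sum, hFsum, mul_one, hρt]
      simp [hτ1.ne'])
  refine ⟨g t, Fintype.card κ * w t, hFpos t, ?_, le_trans ?_ ht⟩
  · have h1 : ∑ t, (F t).trace.re = Fintype.card ι := by
      rw [← Complex.re_sum, ← trace_sum, hFsum, trace_one]
      simp
    rw [← h1]
    exact Finset.single_le_sum (f := fun t => (F t).trace.re)
      (fun t _ => (Complex.le_def.1 (hFpos t).trace_nonneg).1) (Finset.mem_univ t)
  · exact inv_anti₀ hτ1 hcard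

lemma abs_trace_mul_le {D F : Matrix ι ι ℂ} {δ : ℝ} (hD : ∀ i j, ‖D i j‖ ≤ δ)
    (hF : F.PosSemidef) (hFt : F.trace.re ≤ Fintype.card ι) :
    |(D * F).trace.re| ≤ (Fintype.card ι : ℝ) ^ 3 * δ := by
  calc |(D * F).trace.re| ≤ ‖(D * F).trace‖ := Complex.abs_re_le_norm _
    _ ≤ ∑ i, ∑ j, ‖D i j * F j i‖ := by
        rw [trace]
        refine (norm_sum_le _ _).trans (Finset.sum_le_sum fun i _ => ?_)
        rw [diag_apply, Matrix.mul_apply]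
        exact norm_sum_le _ _
    _ ≤ ∑ _i : ι, ∑ _j : ι, δ * Fintype.card ι := by
        refine Finset.sum_le_sum fun i _ => Finset.sum_le_sum fun j _ => ?_
        rw [norm_mul]
        exact mul_le_mul (hD i j) ((norm_apply_le_trace hF j i).trans hFt) (norm_nonneg _)
          ((norm_nonneg _).trans (hD i j))
    _ = _ := by
        simp only [Finset.sum_const, Finset.card_univ, nsmul_eq_mul]
        ring

end Effects

lemma abs_sub_le_of_floor_eq {k : ℕ} (hk : 0 < k) {a b : ℝ} (h : ⌊k * a⌋ = ⌊k * b⌋) :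
    |a - b| ≤ 1 / k := by
  have hk' : (0 : ℝ) < k := by exact_mod_cast hk
  have := Int.abs_sub_lt_one_of_floor_eq_floor h
  rw [← mul_sub, abs_mul, abs_of_pos hk'] at this
  rw [le_div_iff₀ hk', mul_comm]
  exact this.le

lemma floor_mem_Icc (k : ℕ) {a : ℝ} (h : |a| ≤ 1) : ⌊k * a⌋ ∈ Finset.Icc (-k : ℤ) k := by
  obtain ⟨h1, h2⟩ := abs_le.1 h
  have hk : (0 : ℝ) ≤ k := Nat.cast_nonneg _
  rw [Finset.mem_Icc]
  constructor
  · rw [Int.le_floor]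
    push_cast
    nlinarith
  · have : ⌊k * a⌋ ≤ ⌊(k : ℝ)⌋ := Int.floor_le_floor (by nlinarith)
    simpa using this

/-- Rounding the entries of the density matrices to multiples of `1 / k` with `k` polynomial in
the dimension yields classes of inputs that shatter no set of size `m`: the effect found for one
member of a class has positive probability on all the others. -/
lemma two_pow_le_of_wins {n m : ℕ} (hn : 12 * m ≤ n) (P : QuantumProtocol n m) (hP : P.Wins 0) :
    2 ^ n ≤ (2 * (7 * (2 ^ P.qubits) ^ 5) + 1) ^ (4 * (2 ^ P.qubits) ^ 2) := by
  obtain ⟨r, hr⟩ := exists_pos_of_mem_stdSimplex P.coin_mem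
  set d := 2 ^ P.qubits with hd
  have hd1 : 1 ≤ d := Nat.one_le_two_pow
  have hcard : Fintype.card (Fin P.qubits → Bool) = d := by simp [hd]
  -- Entrywise errors of `2 / k` change a probability by at most `2 d ^ 3 / k`, which for this `k`
  -- is less than `1 / (2 d ^ 2 + 1)`.
  set k := 7 * d ^ 5 with hk
  have hk0 : 0 < k := by positivity
  have hentry : ∀ x i j, ‖P.state r x i j‖ ≤ 1 := by
    intro x i j
    have := norm_apply_le_trace (P.state_posSemidef r x) i j
    rwa [P.state_trace, Complex.one_re] at this
  let I := Fin P.qubits → Bool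
  let f : AliceInput n → I × I → Finset.Icc (-k : ℤ) k × Finset.Icc (-k : ℤ) k := fun x ij =>
    (⟨⌊k * (P.state r x ij.1 ij.2).re⌋, floor_mem_Icc k
      ((Complex.abs_re_le_norm _).trans (hentry x _ _))⟩,
     ⟨⌊k * (P.state r x ij.1 ij.2).im⌋, floor_mem_Icc k
      ((Complex.abs_im_le_norm _).trans (hentry x _ _))⟩)
  have hclose : ∀ x x', f x = f x' → ∀ i j, ‖(P.state r x - P.state r x') i j‖ ≤ 2 / k := by
    intro x x' h i j
    have h1 := congrFun h (i, j)
    have hre := abs_sub_le_of_floor_eq hk0 (congrArg (fun p => (p.1 : ℤ)) h1)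
    have him := abs_sub_le_of_floor_eq hk0 (congrArg (fun p => (p.2 : ℤ)) h1)
    refine (Complex.norm_le_abs_re_add_abs_im _).trans ?_
    rw [Matrix.sub_apply, Complex.sub_re, Complex.sub_im]
    calc _ ≤ 1 / (k : ℝ) + 1 / k := add_le_add hre him
      _ = 2 / k := by ring
  have key := two_pow_le_card_sq hn f ?_
  · refine key.trans_eq ?_
    simp only [Fintype.card_fun, Fintype.card_prod, I, hcard, Fintype.card_coe, Int.card_Icc]
    have : ((k : ℤ) + 1 - -(k : ℤ)).toNat = 2 * k + 1 := by omega
    rw [this, ← pow_mul, ← sq, ← pow_mul]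
    congr 1
    ring
  · intro c y
    by_cases hc : ∃ x₀, f x₀ = c
    · obtain ⟨x₀, hx₀⟩ := hc
      obtain ⟨z, s, hpos, htr, hge⟩ := exists_effect_trace_ge (P.povm r y)
        (P.povm_posSemidef r y) (P.povm_sum r y) (P.state_trace r x₀)
      refine ⟨z, fun x hx hxz => ?_⟩
      have h0 : (P.state r x * s • P.povm r y z).trace.re = 0 := by
        rw [Matrix.mul_smul, trace_smul, Complex.smul_re, ← hxz,
          P.trace_eq_zero_of_wins (by omega) hP hr x y, smul_zero]
      have h1 := abs_trace_mul_le (hclose x₀ x (hx₀.trans hx.symm)) hpos htr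
      rw [sub_mul, trace_sub, Complex.sub_re, h0, sub_zero, hcard] at h1
      rw [hcard] at hge
      have h2 := hge.trans ((le_abs_self _).trans h1)
      have hd1' : (1 : ℝ) ≤ d := by exact_mod_cast hd1
      have hk' : (k : ℝ) = 7 * (d : ℝ) ^ 5 := by rw [hk]; push_cast; ring
      rw [hk', inv_le_iff_one_le_mul₀ (by positivity)] at h2
      have h3 : (d : ℝ) ^ 3 * (2 / (7 * (d : ℝ) ^ 5)) * (2 * (d : ℝ) ^ 2 + 1)
          = (4 * (d : ℝ) ^ 2 + 2) / (7 * (d : ℝ) ^ 2) := by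
        field_simp
        ring
      rw [h3, le_div_iff₀ (by positivity)] at h2
      nlinarith
    · exact ⟨fun _ => false, fun x hx => absurd ⟨x, hx⟩ hc⟩

lemma le_of_wins {n m : ℕ} (hn : 12 * m ≤ n) (P : QuantumProtocol n m) (hP : P.Wins 0) :
    n ≤ 36 * 8 ^ P.qubits := by
  set q := P.qubits
  have hq : q < 2 ^ q := Nat.lt_two_pow_self
  have h1 : 2 * (7 * (2 ^ q) ^ 5) + 1 ≤ 2 ^ (4 + 5 * q) := by
    have : 1 ≤ (2 ^ q) ^ 5 := Nat.one_le_pow _ _ (by positivity)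
    rw [pow_add, mul_comm 5 q, pow_mul]
    omega
  have h2 : 2 ^ n ≤ 2 ^ ((4 + 5 * q) * (4 * (2 ^ q) ^ 2)) := by
    rw [pow_mul]
    exact (two_pow_le_of_wins hn P hP).trans (Nat.pow_le_pow_left h1 _)
  have h3 := (Nat.pow_le_pow_iff_right (by norm_num)).1 h2
  have h4 : 4 + 5 * q ≤ 9 * 2 ^ q := by omega
  calc n ≤ (4 + 5 * q) * (4 * (2 ^ q) ^ 2) := h3
    _ ≤ 9 * 2 ^ q * (4 * (2 ^ q) ^ 2) := Nat.mul_le_mul_right _ h4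
    _ = 36 * (2 ^ q) ^ 3 := by ring
    _ = 36 * 8 ^ q := by rw [← pow_mul, mul_comm q 3, pow_mul]; norm_num

lemma le_quantumCC {n m : ℕ} (hm : 1 ≤ m) (hn : 12 * m ≤ n) :
    n ≤ 36 * 8 ^ quantumCC n m 0 := by
  obtain ⟨a, b, h1, hab, -⟩ := exists_angle hm
  obtain ⟨P, hP, hq⟩ := Nat.sInf_mem (s := {q : ℕ | ∃ P : QuantumProtocol n m,
    P.Wins 0 ∧ P.qubits = q}) ⟨_, exclusionProtocol n m h1, exclusionProtocol_wins h1 hab, rfl⟩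
  have := le_of_wins hn P hP
  rwa [hq] at this

lemma log_le_quantumCC {n m : ℕ} (hm : 1 ≤ m) (hn : 12 * m ≤ n) (h36 : 36 < n) :
    Real.log n ≤ 7 * quantumCC n m 0 := by
  have h := le_quantumCC hm hn
  set q := quantumCC n m 0
  have hq : 1 ≤ q := by
    by_contra hq
    have : q = 0 := by omega
    rw [this] at h
    omega
  have hq' : (1 : ℝ) ≤ q := by exact_mod_cast hq
  have h1 : (n : ℝ) ≤ 36 * 8 ^ q := by exact_mod_cast h
  have h2 : 36 * (8 : ℝ) ^ q ≤ Real.exp 1 ^ (7 * q) := by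
    have he : (2.7 : ℝ) ≤ Real.exp 1 := by linarith [Real.exp_one_gt_d9]
    have h3 : (288 : ℝ) ≤ Real.exp 1 ^ 7 :=
      le_trans (by norm_num) (pow_le_pow_left₀ (by norm_num) he 7)
    calc 36 * (8 : ℝ) ^ q ≤ 36 ^ q * 8 ^ q := by
          gcongr
          exact le_self_pow₀ (by norm_num) (by omega)
      _ = 288 ^ q := by rw [← mul_pow]; norm_num
      _ ≤ (Real.exp 1 ^ 7) ^ q := pow_le_pow_left₀ (by norm_num) h3 q
      _ = _ := by rw [← pow_mul]
  have h4 := Real.log_le_log (by exact_mod_cast (by omega : 0 < n)) (h1.trans h2)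
  rw [Real.log_pow, Real.log_exp, mul_one] at h4
  exact_mod_cast h4

/-! ### Asymptotics -/

section Asymptotics

variable {m : ℕ → ℕ}

lemma eventually_two_le
    (h : (fun n : ℕ => Real.sqrt ((n : ℝ) * Real.log n)) =o[atTop] fun n => (m n : ℝ)) :
    ∀ᶠ n in atTop, 2 ≤ m n := by
  filter_upwards [h.def one_pos, eventually_ge_atTop 4] with n hn h4
  have h4' : (4 : ℝ) ≤ n := by exact_mod_cast h4
  have hlog : 1 ≤ Real.log n := by
    rw [Real.le_log_iff_exp_le (by linarith)]
    linarith [Real.exp_one_lt_d9]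
  have h2 : (2 : ℝ) ≤ √((n : ℝ) * Real.log n) := Real.le_sqrt_of_sq_le (by nlinarith)
  rw [one_mul, Real.norm_natCast] at hn
  have : (2 : ℝ) ≤ m n := h2.trans ((le_abs_self _).trans hn)
  exact_mod_cast this

lemma eventually_twelve_mul_le (h : SoftLittleO fun n => (m n : ℝ)) :
    ∀ᶠ n in atTop, 12 * m n ≤ n := by
  filter_upwards [(h 0).def (by norm_num : (0 : ℝ) < 1 / 12)] with n hn
  rw [zpow_zero, mul_one, Real.norm_natCast, Real.norm_natCast] at hn
  have : (12 : ℝ) * m n ≤ n := by linarith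
  exact_mod_cast this

lemma infiniteGap_one_of_tendsto_zero {f : ℕ → ℝ} (hf : ∀ᶠ n in atTop, 0 < f n)
    (h0 : Tendsto f atTop (𝓝 0)) : InfiniteGap f fun _ => 1 := by
  rintro ⟨g, hg, hequiv⟩
  simp only [Real.log_one] at hequiv
  have hz := isEquivalent_zero_iff_eventually_zero.1 hequiv.symm
  -- Positivity matters here: otherwise the value `0` of `Real.log 0` could occur.
  have hlog : Tendsto (fun n => Real.log (f n)) atTop atBot :=
    Real.tendsto_log_nhdsGT_zero.comp (tendsto_nhdsWithin_iff.2 ⟨h0, hf⟩)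
  obtain ⟨k, hk⟩ := hz.exists
  obtain ⟨l, hl, hlt⟩ := (hz.and (hlog.eventually_lt_atBot (Real.log (f k)))).exists
  have := hg hlt
  simp only [Pi.zero_apply] at hk hl
  rw [hk, hl] at this
  exact lt_irrefl _ this

lemma infiniteGap_one_of_tendsto_atTop {f : ℕ → ℝ} (h : Tendsto f atTop atTop) :
    InfiniteGap (fun _ => 1) f := by
  rintro ⟨g, -, hequiv⟩
  exact not_tendsto_nhds_of_tendsto_atTop (Real.tendsto_log_atTop.comp h) _
    (hequiv.symm.tendsto_nhds tendsto_const_nhds)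

lemma limRatioGeOne_of_tendsto_atTop {f g : ℕ → ℝ} (h : Tendsto (fun n => g n / f n) atTop atTop) :
    LimRatioGeOne f g :=
  ⟨⊤, le_top, EReal.tendsto_coe_nhds_top_iff.2 h⟩

/-- The constant `1` separates a function tending to `0` from one tending to infinity. -/
lemma doublyInfiniteGap_of_tendsto {f g : ℕ → ℝ} (hf : ∀ᶠ n in atTop, 0 < f n)
    (h0 : Tendsto f atTop (𝓝 0)) (hg : Tendsto g atTop atTop) : DoublyInfiniteGap f g := by
  have hinv : Tendsto (fun n => (f n)⁻¹) atTop atTop :=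
    tendsto_inv_nhdsGT_zero.comp (tendsto_nhdsWithin_iff.2 ⟨h0, hf⟩)
  refine ⟨hf, hg.eventually_gt_atTop 0, ?_, fun _ => 1, by simp, ?_, ?_,
    infiniteGap_one_of_tendsto_zero hf h0, infiniteGap_one_of_tendsto_atTop hg⟩
  · exact limRatioGeOne_of_tendsto_atTop (hg.atTop_mul_atTop₀ hinv)
  · exact limRatioGeOne_of_tendsto_atTop (by simpa using hg)
  · exact limRatioGeOne_of_tendsto_atTop (by simpa using hinv)

lemma tendsto_quantumIC
    (hlow : (fun n : ℕ => Real.sqrt ((n : ℝ) * Real.log n)) =o[atTop] fun n => (m n : ℝ))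
    (hup : SoftLittleO fun n => (m n : ℝ)) :
    Tendsto (fun n : ℕ => quantumIC n (m n) 0) atTop (𝓝 0) := by
  have h1 : Tendsto (fun n : ℕ => 14 * (√((n : ℝ) * Real.log n) / m n) ^ 2) atTop (𝓝 0) := by
    simpa using (hlow.tendsto_div_nhds_zero.pow 2).const_mul 14
  refine squeeze_zero' ?_ ?_ h1
  · filter_upwards [eventually_two_le hlow, eventually_twelve_mul_le hup] with n h2 h12
    exact (quantumIC_pos (by omega) (by omega)).le
  · filter_upwards [eventually_two_le hlow, eventually_twelve_mul_le hup] with n h2 h12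
    refine (quantumIC_le h2 (by omega)).trans ?_
    have hm : (0 : ℝ) < m n := by exact_mod_cast (by omega : 0 < m n)
    have hn : (1 : ℝ) ≤ n := by exact_mod_cast (by omega : 1 ≤ n)
    rw [div_pow, Real.sq_sqrt (mul_nonneg (by linarith) (Real.log_nonneg hn)), div_eq_mul_inv,
      mul_right_comm]
    have hlog : Real.log (m n) ≤ Real.log n :=
      Real.log_le_log hm (by exact_mod_cast (by omega : m n ≤ n))
    gcongr

end Asymptotics

end Exclusion

end

theorem corollary1 (m : ℕ → ℕ)
    (hm_lower : (fun n : ℕ => Real.sqrt ((n : ℝ) * Real.log n)) =o[atTop] fun n => (m n : ℝ))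
    (hm_upper : Exclusion.SoftLittleO fun n => (m n : ℝ)) :
    ((fun n : ℕ => Exclusion.quantumIC n (m n) 0) =O[atTop]
        fun n : ℕ => (n : ℝ) * ((m n : ℝ) ^ 2)⁻¹ * Real.log (m n)) ∧
    Tendsto (fun n : ℕ => Exclusion.quantumIC n (m n) 0) atTop (𝓝 0) ∧
    ((fun n : ℕ => Real.log n) =O[atTop] fun n : ℕ => (Exclusion.quantumCC n (m n) 0 : ℝ)) ∧
    Tendsto (fun n : ℕ => Exclusion.quantumCC n (m n) 0) atTop atTop ∧
    ((fun n : ℕ => (Exclusion.classicalCC n (m n) 0 : ℝ)) =Θ[atTop] fun n : ℕ => (n : ℝ)) ∧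
    Exclusion.DoublyInfiniteGap (fun n : ℕ => Exclusion.quantumIC n (m n) 0)
      (fun n : ℕ => (Exclusion.quantumCC n (m n) 0 : ℝ)) ∧
    Exclusion.AtMostExponentialGap (fun n : ℕ => (Exclusion.quantumCC n (m n) 0 : ℝ))
      (fun n : ℕ => (Exclusion.classicalCC n (m n) 0 : ℝ)) := by
  have h2 := Exclusion.eventually_two_le hm_lower
  have h12 := Exclusion.eventually_twelve_mul_le hm_upper
  have hpos : ∀ᶠ n in atTop, 0 < Exclusion.quantumIC n (m n) 0 := by
    filter_upwards [h2, h12] with n h2 h12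
    exact Exclusion.quantumIC_pos (by omega) (by omega)
  have hlog : ∀ᶠ n : ℕ in atTop, Real.log n ≤ 7 * (Exclusion.quantumCC n (m n) 0 : ℝ) := by
    filter_upwards [h2, h12, eventually_gt_atTop 36] with n h2 h12 h36
    exact Exclusion.log_le_quantumCC (by omega) h12 h36
  have hIC := Exclusion.tendsto_quantumIC hm_lower hm_upper
  have hCC : Tendsto (fun n : ℕ => (Exclusion.quantumCC n (m n) 0 : ℝ)) atTop atTop := by
    have h7 : Tendsto (fun n : ℕ => Real.log n / 7) atTop atTop :=
      (Real.tendsto_log_atTop.comp tendsto_natCast_atTop_atTop).atTop_div_const (by norm_num)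
    refine tendsto_atTop_mono' _ ?_ h7
    filter_upwards [hlog] with n hn
    linarith
  refine ⟨?_, hIC, ?_, tendsto_natCast_atTop_iff.1 hCC, ⟨?_, ?_⟩,
    Exclusion.doublyInfiniteGap_of_tendsto hpos hIC hCC, 14, ?_⟩
  · refine IsBigO.of_bound 14 ?_
    filter_upwards [h2, h12, hpos] with n h2 h12 hpos
    rw [Real.norm_of_nonneg hpos.le]
    exact (Exclusion.quantumIC_le h2 (by omega)).trans
      (mul_le_mul_of_nonneg_left (le_abs_self _) (by norm_num))
  · refine IsBigO.of_bound 7 ?_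
    filter_upwards [hlog] with n hn
    rw [Real.norm_of_nonneg (Real.log_natCast_nonneg n), Real.norm_natCast]
    exact hn
  · refine IsBigO.of_bound 1 ?_
    filter_upwards [h2] with n h2
    rw [Real.norm_natCast, Real.norm_natCast, one_mul]
    exact_mod_cast Exclusion.classicalCC_le (by omega)
  · refine IsBigO.of_bound 4 ?_
    filter_upwards [h2, h12] with n h2 h12
    rw [Real.norm_natCast, Real.norm_natCast]
    exact_mod_cast Exclusion.le_four_mul_classicalCC (by omega) h12
  · filter_upwards [h2, h12, hlog] with n h2 h12 hn
    have hn0 : (0 : ℝ) < n := by exact_mod_cast (by omega : 0 < n)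
    have hC : (Exclusion.classicalCC n (m n) 0 : ℝ) ≤ n := by
      exact_mod_cast Exclusion.classicalCC_le (by omega)
    refine hC.trans ?_
    rw [Real.rpow_def_of_pos (by norm_num), ← Real.log_le_iff_le_exp hn0]
    have hl : 1 / 2 ≤ Real.log 2 := by linarith [Real.log_two_gt_d9]
    have hq : (0 : ℝ) ≤ Exclusion.quantumCC n (m n) 0 := Nat.cast_nonneg _
    nlinarith
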